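/- Let $\omega,\varepsilon_0,\mu_0>0$, put $k_0=\omega\sqrt{\varepsilon_0\mu_0}$, and let $\Omega\subset\mathbb R^3$ be a bounded open set. Let $\varepsilon^{\rm eff}$ be a real symmetric positive definite $3\times 3$ matrix, and let $\mu^{\rm eff}$ be a complex $3\times3$ matrix that is symmetric ($\mu^{\rm eff}_{kl}=\mu^{\rm eff}_{lk}$) and whose (entrywise) imaginary part $\Im(\mu^{\rm eff})$ is positive definite. Set $$\varepsilon(x)=\begin{cases}\varepsilon^{\rm eff}& x\in\Omega\\ I_3& x\notin\Omega\end{cases},\qquad \mu(x)=\begin{cases}\mu^{\rm eff}& x\in\Omega\\ I_3& x\notin\Omega.\end{cases}$$ Let $E^{\rm inc},H^{\rm inc}:\mathbb R^3\to\mathbb C^3$ be given incident fields. Then the homogenized diffraction problem $$\operatorname{curl}E=i\omega\mu_0\,\mu(x)H,\qquad \operatorname{curl}H=-i\omega\varepsilon_0\,\varepsilon(x)E\qquad\text{in the sense of distributions on }\mathbb R^3,$$ with the Silver–Müller radiation condition for $E^d=E-E^{\rm inc}$, $H^d=H-H^{\rm inc}$, $$(E^d,H^d)=O\Big(\frac1{|x|}\Big),\qquad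 \omega\varepsilon_0\Big(\frac{x}{|x|}\wedge E^d\Big)-k_0H^d=o\Big(\frac1{|x|}\Big)\qquad\text{as }|x|\to\infty$$ (for almost every $x$), has at most one solution $(E,H)\in L^2_{\rm loc}(\mathbb R^3;\mathbb C^3)^2$: any two solutions $(E_1,H_1)$, $(E_2,H_2)$ with the same incident fields satisfy $E_1=E_2$ and $H_1=H_2$ almost everywhere in $\mathbb R^3$. -/

import Mathlib

open MeasureTheory Filter Asymptotics
open scoped Matrix

noncomputable section

namespace MaxwellDiffraction

/-- Physical space, with the Euclidean norm. -/
abbrev R3 : Type := EuclideanSpace ℝ (Fin 3)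

/-- Values of complex vector fields, with the Hermitian norm. -/
abbrev C3 : Type := EuclideanSpace ℂ (Fin 3)

/-- The partial derivative `∂ⱼ φᵢ` at `x`. -/
def pderiv (φ : R3 → C3) (j i : Fin 3) (x : R3) : ℂ :=
  fderiv ℝ φ x (EuclideanSpace.single j 1) i

/-- The classical curl of a (differentiable) complex vector field. -/
def curl (φ : R3 → C3) (x : R3) : C3 :=
  !₂[pderiv φ 1 2 x - pderiv φ 2 1 x,
     pderiv φ 2 0 x - pderiv φ 0 2 x,
     pderiv φ 0 1 x - pderiv φ 1 0 x]

/-- `u ∈ L²_loc(ℝ³; ℂ³)`. -/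
def MemL2Loc (u : R3 → C3) : Prop :=
  ∀ K : Set R3, IsCompact K → MemLp u 2 (volume.restrict K)

/-- `curl u = w` in the sense of distributions on `ℝ³` (for `u`, `w` locally integrable):
`∫ u · curl φ = ∫ w · φ` for every test field `φ ∈ C_c^∞(ℝ³; ℂ³)`, where `·` is the bilinear
product `a · b = ∑ᵢ aᵢ bᵢ`. -/
def HasDistribCurl (u w : R3 → C3) : Prop :=
  ∀ φ : R3 → C3, ContDiff ℝ (⊤ : ℕ∞) φ → HasCompactSupport φ →
    ∫ x, ∑ i, u x i * curl φ x i = ∫ x, ∑ i, w x i * φ x i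

open Classical in
/-- The tensor field equal to the constant tensor `A` in `Ω` and to the identity outside `Ω`. -/
def tensorField (Ω : Set R3) (A : Matrix (Fin 3) (Fin 3) ℂ) (x : R3) :
    Matrix (Fin 3) (Fin 3) ℂ :=
  if x ∈ Ω then A else 1

/-- Pointwise application of a tensor field to a vector field. -/
def applyTensor (A : R3 → Matrix (Fin 3) (Fin 3) ℂ) (u : R3 → C3) (x : R3) : C3 :=
  WithLp.toLp 2 (A x *ᵥ (u x).ofLp)

/-- `(x / |x|) ∧ v` for `x ∈ ℝ³` and `v ∈ ℂ³`. -/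
def radialCross (x : R3) (v : C3) : C3 :=
  WithLp.toLp 2 (crossProduct (fun i => ((x i / ‖x‖ : ℝ) : ℂ)) v.ofLp)

/-- The filter "`|x| → ∞`, almost everywhere": a property holds along it iff, for some `R`, it
holds for almost every `x` with `|x| > R`. It makes asymptotic relations at infinity meaningful
for fields that are only defined up to null sets. -/
def aeInfinity : Filter R3 := Bornology.cobounded R3 ⊓ ae volume

/-- The wave number `k₀ = ω √(ε₀ μ₀)`. -/
def waveNumber (ω ε₀ μ₀ : ℝ) : ℝ := ω * Real.sqrt (ε₀ * μ₀)

/-- The Silver–Müller radiation condition (time dependence `e^{-iωt}`): `E, H = O(1/|x|)` and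
`ω ε₀ (x/|x| ∧ E) - k₀ H = o(1/|x|)` as `|x| → ∞`. -/
structure SilverMuller (ω ε₀ μ₀ : ℝ) (E H : R3 → C3) : Prop where
  E_isBigO : E =O[aeInfinity] fun x => ‖x‖⁻¹
  H_isBigO : H =O[aeInfinity] fun x => ‖x‖⁻¹
  isLittleO : (fun x => ((ω * ε₀ : ℝ) : ℂ) • radialCross x (E x)
      - (waveNumber ω ε₀ μ₀ : ℂ) • H x) =o[aeInfinity] fun x => ‖x‖⁻¹

/-- `(E, H)` is a (finite energy) solution of the homogenized diffraction problem with incident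
field `(Einc, Hinc)`:
`curl E = i ω μ₀ μ(x) H`, `curl H = - i ω ε₀ ε(x) E` in the sense of distributions on `ℝ³`, and
`(E - Einc, H - Hinc)` satisfies the Silver–Müller condition. Here `ε(x)` and `μ(x)` are equal to
`εeff` and `μeff` in `Ω` and to the identity outside `Ω`. -/
structure IsSolution (ω ε₀ μ₀ : ℝ) (Ω : Set R3) (εeff : Matrix (Fin 3) (Fin 3) ℝ)
    (μeff : Matrix (Fin 3) (Fin 3) ℂ) (Einc Hinc E H : R3 → C3) : Prop where
  E_memL2Loc : MemL2Loc E
  H_memL2Loc : MemL2Loc H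
  curl_E : HasDistribCurl E fun x =>
    (Complex.I * ω * μ₀) • applyTensor (tensorField Ω μeff) H x
  curl_H : HasDistribCurl H fun x =>
    (-Complex.I * ω * ε₀) • applyTensor (tensorField Ω (εeff.map Complex.ofReal)) E x
  radiation : SilverMuller ω ε₀ μ₀ (fun x => E x - Einc x) (fun x => H x - Hinc x)

end MaxwellDiffraction

end

noncomputable section

namespace MaxwellDiffraction

open Topology ComplexConjugate
open scoped ContDiff

/-! The difference `(E, H)` of two solutions solves the homogeneous system, with `α = ωε₀`, `β =
ωμ₀` and `k² = αβ`, and the incident fields cancel in the radiation condition. Pairing the equation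
for `curl E` with `χ H̄`, where `χ` is a radial cutoff at scale `R`, and taking real parts gives
`energy_identity`: the outgoing flux through a thick shell and the power absorbed in `Ω` sum to
zero, since a real symmetric `ε` dissipates nothing. By the radiation condition the flux is at least
a multiple of `R⁻¹ ∫ |H|²` over the shell, up to an error that tends to zero (`energy_estimate`).
Both nonnegative quantities are therefore negligible: `H = 0` in `Ω`, because `Im μ` is positive
definite, and `R⁻¹ ∫ |H|²` over the shell tends to zero.

Since `Ω` is open, `curl H = 0` there, and invertibility of `ε` gives `E = 0` in `Ω`. The tensors
can then be replaced by the identity, so `(E, H)` solves the vacuum system on all of `ℝ³`. No unique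
continuation across `∂Ω` is needed.

Each component of `H` is now an entire Helmholtz solution that decays faster than `1/|x|` in mean.
It is tested with differences of spherical waves `cos(kr)/r` truncated near their centre at scales
`t` and `R` (`integral_waveSource_eq`). The source at scale `R` sees only the far field and
contributes nothing in the limit, while the source at scale `t` tends to `-4πδ` as `t → 0`. Hence `H
= 0` at almost every point (`ae_eq_zero_of_helmholtz`), and then `E = 0` from `curl H`. -/

/-- The partial derivative `∂ⱼ f`. -/
def pd {F : Type*} [NormedAddCommGroup F] [NormedSpace ℝ F] (f : R3 → F) (j : Fin 3) (x : R3) : F :=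
  fderiv ℝ f x (EuclideanSpace.single j 1)

/-! ### Partial derivatives and the curl in components. -/

section pd

variable {F : Type*} [NormedAddCommGroup F] [NormedSpace ℝ F]

lemma pd_smul {c : R3 → ℝ} {f : R3 → F} {j : Fin 3} {x : R3} (hc : DifferentiableAt ℝ c x)
    (hf : DifferentiableAt ℝ f x) :
    pd (fun y => c y • f y) j x = pd c j x • f x + c x • pd f j x := by
  simp [pd, fderiv_fun_smul hc hf, add_comm]

lemma contDiff_pd {f : R3 → F} (hf : ContDiff ℝ ∞ f) (j : Fin 3) : ContDiff ℝ ∞ (pd f j) :=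
  (hf.fderiv_right (m := ∞) (by simp)).clm_apply contDiff_const

lemma hasCompactSupport_pd {f : R3 → F} (hf : HasCompactSupport f) (j : Fin 3) :
    HasCompactSupport (pd f j) :=
  hf.fderiv_apply (𝕜 := ℝ) _

lemma pd_comm {f : R3 → F} (hf : ContDiff ℝ ∞ f) (i j : Fin 3) (x : R3) :
    pd (pd f i) j x = pd (pd f j) i x := by
  have h2 : ContDiffAt ℝ 2 f x := (contDiff_infty.1 hf 2).contDiffAt
  have hsym := h2.isSymmSndFDerivAt (by simp)
  have hd : DifferentiableAt ℝ (fderiv ℝ f) x :=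
    ((hf.fderiv_right (m := ∞) (by simp)).differentiable (by simp)).differentiableAt
  have key : ∀ i j : Fin 3, pd (pd f i) j x =
      fderiv ℝ (fderiv ℝ f) x (EuclideanSpace.single j 1) (EuclideanSpace.single i 1) := by
    intro i j
    change fderiv ℝ (fun y => fderiv ℝ f y (EuclideanSpace.single i 1)) x _ = _
    rw [fderiv_clm_apply hd (by fun_prop)]
    simp
  rw [key, key]
  exact hsym _ _

lemma pd_ofReal {f : R3 → ℝ} {j : Fin 3} {x : R3} (hf : DifferentiableAt ℝ f x) :
    pd (fun y => (f y : ℂ)) j x = ((pd f j x : ℝ) : ℂ) := by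
  have := (Complex.ofRealCLM.hasFDerivAt (x := f x)).comp x hf.hasFDerivAt
  simp only [pd]
  rw [show (fun y => (f y : ℂ)) = Complex.ofRealCLM ∘ f from rfl, this.fderiv]
  simp

end pd

lemma pderiv_eq_pd {φ : R3 → C3} {x : R3} (hφ : DifferentiableAt ℝ φ x) (j i : Fin 3) :
    pderiv φ j i x = pd (fun y => φ y i) j x := by
  have := (((EuclideanSpace.proj i : C3 →L[ℂ] ℂ).restrictScalars ℝ).hasFDerivAt (x := φ x)).comp x
    hφ.hasFDerivAt
  simp only [pd, pderiv]
  rw [show (fun y => φ y i) = ((EuclideanSpace.proj i : C3 →L[ℂ] ℂ).restrictScalars ℝ) ∘ φ from rfl,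
    this.fderiv]
  simp

/-- A distributional curl, tested with a field given by its components. -/
lemma HasDistribCurl.test {u w : R3 → C3} (h : HasDistribCurl u w) {f g k : R3 → ℂ}
    (hf : ContDiff ℝ ∞ f) (hg : ContDiff ℝ ∞ g) (hk : ContDiff ℝ ∞ k)
    (hf' : HasCompactSupport f) (hg' : HasCompactSupport g) (hk' : HasCompactSupport k) :
    ∫ x, (u x 0 * (pd k 1 x - pd g 2 x) + u x 1 * (pd f 2 x - pd k 0 x)
      + u x 2 * (pd g 0 x - pd f 1 x)) = ∫ x, (w x 0 * f x + w x 1 * g x + w x 2 * k x) := by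
  set φ : R3 → C3 := fun x => !₂[f x, g x, k x] with hφ
  have hφs : ContDiff ℝ ∞ φ := by
    refine (PiLp.continuousLinearEquiv 2 ℝ (fun _ : Fin 3 => ℂ)).symm.contDiff.comp
      (contDiff_pi.2 fun i => ?_ : ContDiff ℝ ∞ fun x => ![f x, g x, k x])
    fin_cases i <;> simpa
  have hφc : HasCompactSupport φ := by
    refine HasCompactSupport.intro (hf'.isCompact.union (hg'.isCompact.union hk'.isCompact)) ?_
    intro x hx
    simp only [Set.mem_union, not_or] at hx
    ext i
    fin_cases i <;>
      simp [hφ, image_eq_zero_of_notMem_tsupport hx.1, image_eq_zero_of_notMem_tsupport hx.2.1,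
        image_eq_zero_of_notMem_tsupport hx.2.2]
  have := h φ hφs hφc
  have hd : ∀ x, DifferentiableAt ℝ φ x := fun x => (hφs.differentiable (by simp)).differentiableAt
  simp only [Fin.sum_univ_three, curl, pderiv_eq_pd (hd _)] at this
  simpa [hφ] using this

/-! ### Scalar functions in `L²_loc`. -/

/-- `f ∈ L²_loc(ℝ³)`, for scalar functions. -/
def L2Loc (f : R3 → ℂ) : Prop :=
  ∀ K : Set R3, IsCompact K → MemLp f 2 (volume.restrict K)

lemma MemL2Loc.component {u : R3 → C3} (hu : MemL2Loc u) (i : Fin 3) : L2Loc fun x => u x i :=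
  fun K hK => (EuclideanSpace.proj i : C3 →L[ℂ] ℂ).comp_memLp' (hu K hK)

namespace L2Loc

variable {f g : R3 → ℂ}

lemma sub (hf : L2Loc f) (hg : L2Loc g) : L2Loc fun x => f x - g x :=
  fun K hK => (hf K hK).sub (hg K hK)

lemma star (hf : L2Loc f) : L2Loc fun x => conj (f x) :=
  fun K hK => (hf K hK).star

lemma aestronglyMeasurable (hf : L2Loc f) : AEStronglyMeasurable f volume := by
  have h : ∀ n : ℕ, AEStronglyMeasurable f (volume.restrict (Metric.closedBall (0 : R3) n)) :=
    fun n => (hf _ (isCompact_closedBall _ _)).1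
  have := (aestronglyMeasurable_iUnion_iff (μ := volume)).2 h
  rwa [Metric.iUnion_closedBall_nat, Measure.restrict_univ] at this

lemma locallyIntegrable (hf : L2Loc f) : LocallyIntegrable f volume := by
  rw [locallyIntegrable_iff]
  intro K hK
  have : IsFiniteMeasure (volume.restrict K) := ⟨by simpa using hK.measure_lt_top⟩
  exact (hf K hK).integrable one_le_two

lemma bdd_mul {c : R3 → ℂ} (hf : L2Loc f) (hc : AEStronglyMeasurable c volume) {C : ℝ}
    (hC : ∀ x, ‖c x‖ ≤ C) : L2Loc fun x => c x * f x := fun K hK =>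
  (hf K hK).of_le_mul (c := C) (hc.restrict.mul (hf K hK).1) (Eventually.of_forall fun x => by
    rw [norm_mul]; exact mul_le_mul_of_nonneg_right (hC x) (norm_nonneg _))

lemma test_mul {c : R3 → ℂ} (hf : L2Loc f) (hc : Continuous c) (hcs : HasCompactSupport c) :
    L2Loc fun x => c x * f x :=
  let ⟨_, hC⟩ := hcs.exists_bound_of_continuous hc
  hf.bdd_mul hc.aestronglyMeasurable hC

lemma memLp_indicator (hf : L2Loc f) {K : Set R3} (hK : IsCompact K) :
    MemLp (K.indicator f) 2 volume :=
  (memLp_indicator_iff_restrict hK.measurableSet).2 (hf K hK)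

lemma memLp (hf : L2Loc f) (hfs : HasCompactSupport f) : MemLp f 2 volume := by
  rw [← Set.indicator_eq_self.2 (subset_tsupport f)]
  exact hf.memLp_indicator hfs

lemma integrable_mul (hf : L2Loc f) (hfs : HasCompactSupport f) (hg : L2Loc g) :
    Integrable fun x => f x * g x := by
  have h := (hf.memLp hfs).integrable_mul (hg.memLp_indicator hfs)
  refine h.congr (Eventually.of_forall fun x => ?_)
  by_cases hx : x ∈ tsupport f
  · simp [hx]
  · simp [image_eq_zero_of_notMem_tsupport hx]

lemma integrable_mul_test (hf : L2Loc f) (hg : Continuous g) (hgs : HasCompactSupport g) :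
    Integrable fun x => f x * g x :=
  (hf.locallyIntegrable.integrable_smul_right_of_hasCompactSupport hg hgs).congr
    (Eventually.of_forall fun x => by simp)

end L2Loc

/-! ### Mollification and bilinear pairings. -/

/-- Translation is strongly continuous on `L²`, and the integral is the inner product of `p̄` with a
translate of `q`. -/
lemma continuous_integral_mul_translate_of_memLp {p q : R3 → ℂ} (hp : MemLp p 2 volume)
    (hq : MemLp q 2 volume) : Continuous fun y => ∫ x, p x * q (x - y) := by
  have hmp : ∀ y : R3, MeasurePreserving (fun x : R3 => x - y) volume volume :=
    fun y => measurePreserving_sub_right volume y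
  let τ : R3 → C(R3, R3) := fun y => ⟨fun x => x - y, by fun_prop⟩
  have hτ : Continuous τ := by
    refine ContinuousMap.continuous_of_continuous_uncurry _ ?_
    change Continuous fun z : R3 × R3 => z.2 - z.1
    fun_prop
  have hc := (continuous_const (y := hq.toLp q)).compMeasurePreservingLp hτ hmp (by simp)
  have hp' : MemLp (fun x => conj (p x)) 2 volume := hp.star
  have := (continuous_const (y := hp'.toLp _)).inner (𝕜 := ℂ) hc
  refine this.congr fun y => ?_
  rw [L2.inner_def]
  refine integral_congr_ae ?_
  have h2 := Lp.coeFn_compMeasurePreserving (hq.toLp q) (hmp y)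
  have h3 := (hmp y).quasiMeasurePreserving.ae_eq_comp hq.coeFn_toLp
  filter_upwards [hp'.coeFn_toLp, h2, h3] with x h1 h2 h3
  have h4 : (Lp.compMeasurePreserving (τ y) (hmp y) (hq.toLp q)) x = q (x - y) := by
    rw [show (Lp.compMeasurePreserving (τ y) (hmp y) (hq.toLp q)) x = _ from h2]
    exact h3
  rw [h1, h4]
  simp [mul_comm]

lemma continuous_integral_mul_translate {p q : R3 → ℂ} (hp : L2Loc p) (hps : HasCompactSupport p)
    (hq : L2Loc q) : Continuous fun y => ∫ x, p x * q (x - y) := by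
  rw [continuous_iff_continuousAt]
  intro y₀
  have hK : IsCompact ((fun z : R3 × R3 => z.1 - z.2) '' (tsupport p ×ˢ Metric.closedBall y₀ 1)) :=
    (hps.isCompact.prod (isCompact_closedBall _ _)).image (by fun_prop)
  have h := (continuous_integral_mul_translate_of_memLp (hp.memLp hps)
    (hq.memLp_indicator hK)).continuousAt (x := y₀)
  refine h.congr ?_
  filter_upwards [Metric.closedBall_mem_nhds y₀ one_pos] with y hy
  refine integral_congr_ae (Eventually.of_forall fun x => ?_)
  by_cases hx : x ∈ tsupport p
  · simp only
    rw [Set.indicator_of_mem]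
    exact ⟨(x, y), ⟨hx, hy⟩, rfl⟩
  · simp [image_eq_zero_of_notMem_tsupport hx]

/-- The mollification `ρ ⋆ q`. -/
def mollify (ρ : R3 → ℝ) (q : R3 → ℂ) : R3 → ℂ :=
  convolution ρ q (ContinuousLinearMap.lsmul ℝ ℝ) volume

lemma mollify_eq (ρ : R3 → ℝ) (q : R3 → ℂ) (x : R3) :
    mollify ρ q x = ∫ y, ρ y • q (x - y) := by
  simp [mollify, convolution]

lemma mollify_eq_swap (ρ : R3 → ℝ) (q : R3 → ℂ) (x : R3) :
    mollify ρ q x = ∫ y, ρ (x - y) • q y := by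
  simp [mollify, convolution_eq_swap]

lemma contDiff_mollify {ρ : R3 → ℝ} (hρ : ContDiff ℝ ∞ ρ) (hρs : HasCompactSupport ρ) {q : R3 → ℂ}
    (hq : L2Loc q) : ContDiff ℝ ∞ (mollify ρ q) :=
  hρs.contDiff_convolution_left _ hρ hq.locallyIntegrable

/-- Fubini. Only the values of `q` on the compact set `tsupport p - tsupport ρ` enter, so `q` may be
truncated there to make the double integrand integrable. -/
lemma integral_mul_mollify {ρ : R3 → ℝ} (hρ : Continuous ρ) (hρs : HasCompactSupport ρ)
    {p q : R3 → ℂ} (hp : L2Loc p) (hps : HasCompactSupport p) (hq : L2Loc q) :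
    ∫ y, ρ y • ∫ x, p x * q (x - y) = ∫ x, p x * mollify ρ q x := by
  have hK : IsCompact ((fun z : R3 × R3 => z.1 - z.2) '' (tsupport p ×ˢ tsupport ρ)) :=
    (hps.isCompact.prod hρs.isCompact).image (by fun_prop)
  set K := (fun z : R3 × R3 => z.1 - z.2) '' (tsupport p ×ˢ tsupport ρ)
  set q' := K.indicator q
  have hq' : Integrable q' := by
    rw [integrable_indicator_iff hK.measurableSet]
    exact (locallyIntegrable_iff.1 hq.locallyIntegrable) K hK
  have hp' : Integrable p := by
    rw [← integrableOn_iff_integrable_of_support_subset (subset_tsupport p)]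
    exact (locallyIntegrable_iff.1 hp.locallyIntegrable) _ hps
  obtain ⟨C, hC⟩ := hρs.exists_bound_of_continuous hρ
  have hint : Integrable (fun z : R3 × R3 => ρ z.1 • (p z.2 * q (z.2 - z.1)))
      (volume.prod volume) := by
    have h1 : Integrable (fun z : R3 × R3 => p z.2 * q' (z.2 - z.1)) (volume.prod volume) := by
      have := hp'.convolution_integrand (ContinuousLinearMap.mul ℝ ℂ) hq'.comp_neg
      simpa using this
    have h2 := h1.bdd_smul (φ := fun z : R3 × R3 => ρ z.1) C
      (hρ.comp continuous_fst).aestronglyMeasurable (Eventually.of_forall fun z => hC _)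
    refine h2.congr (Eventually.of_forall fun z => ?_)
    by_cases h1 : z.2 ∈ tsupport p
    · by_cases h2 : z.1 ∈ tsupport ρ
      · have : z.2 - z.1 ∈ K := ⟨(z.2, z.1), ⟨h1, h2⟩, rfl⟩
        simp [q', this]
      · simp [image_eq_zero_of_notMem_tsupport h2]
    · simp [image_eq_zero_of_notMem_tsupport h1]
  calc ∫ y, ρ y • ∫ x, p x * q (x - y) = ∫ y, ∫ x, ρ y • (p x * q (x - y)) := by
        simp only [integral_smul]
    _ = ∫ x, ∫ y, ρ y • (p x * q (x - y)) := integral_integral_swap hint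
    _ = _ := by
        refine integral_congr_ae (Eventually.of_forall fun x => ?_)
        simp only [mollify_eq, ← integral_const_mul, mul_smul_comm]

/-- If a bilinear pairing vanishes on all mollifications of the second arguments, it vanishes. -/
lemma integral_sum_mul_eq_zero_of_mollify {ι : Type*} [Fintype ι] {p q : ι → R3 → ℂ}
    (hp : ∀ a, L2Loc (p a)) (hps : ∀ a, HasCompactSupport (p a)) (hq : ∀ a, L2Loc (q a))
    (h : ∀ ρ : R3 → ℝ, ContDiff ℝ ∞ ρ → HasCompactSupport ρ →
      ∫ x, ∑ a, p a x * mollify ρ (q a) x = 0) :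
    ∫ x, ∑ a, p a x * q a x = 0 := by
  -- `B` is continuous and integrates to zero against every test function `ρ`, so it vanishes
  -- identically, and `B 0` is the pairing in question. No convergence of mollifiers is needed.
  set B : R3 → ℂ := fun y => ∑ a, ∫ x, p a x * q a (x - y) with hB
  have hBc : Continuous B := continuous_finsetSum _ fun a _ =>
    continuous_integral_mul_translate (hp a) (hps a) (hq a)
  have hB0 : ∀ᵐ y ∂(volume : Measure R3), B y = 0 := by
    refine ae_eq_zero_of_integral_contDiff_smul_eq_zero hBc.locallyIntegrable fun ρ hρ hρs => ?_
    rw [← h ρ hρ hρs, integral_finsetSum _ fun a _ => ?_]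
    · simp only [hB, Finset.smul_sum]
      rw [integral_finsetSum _ fun a _ => ?_]
      · exact Finset.sum_congr rfl fun a _ =>
          integral_mul_mollify hρ.continuous hρs (hp a) (hps a) (hq a)
      · exact (hρ.continuous.smul (continuous_integral_mul_translate (hp a) (hps a)
          (hq a))).integrable_of_hasCompactSupport hρs.smul_right
    · have hc := (contDiff_mollify hρ hρs (hq a)).continuous
      refine (hp a).integrable_mul (hps a) fun K hK => ?_
      have : IsFiniteMeasure (volume.restrict K) := ⟨by simpa using hK.measure_lt_top⟩
      obtain ⟨C, hC⟩ := hK.exists_bound_of_continuousOn hc.continuousOn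
      exact MemLp.of_bound hc.aestronglyMeasurable C
        ((ae_restrict_iff' hK.measurableSet).2 (Eventually.of_forall hC))
  have hB1 : B = fun _ => 0 := (hBc.ae_eq_iff_eq volume continuous_const).1 hB0
  rw [integral_finsetSum _ fun a _ => (hp a).integrable_mul (hps a) (hq a)]
  have := congrFun hB1 0
  simpa [hB] using this

/-! ### Conjugation and integration by parts for the curl. -/

/-- The componentwise complex conjugate of a vector field. -/
def conjField (u : R3 → C3) (x : R3) : C3 := WithLp.toLp 2 fun i => conj (u x i)

lemma conjField_apply (u : R3 → C3) (x : R3) (i : Fin 3) : conjField u x i = conj (u x i) := rfl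

lemma contDiff_conjField {u : R3 → C3} (hu : ContDiff ℝ ∞ u) : ContDiff ℝ ∞ (conjField u) := by
  refine (PiLp.continuousLinearEquiv 2 ℝ (fun _ : Fin 3 => ℂ)).symm.contDiff.comp
    (contDiff_pi.2 fun i => ?_ : ContDiff ℝ ∞ fun x => fun i => conj (u x i))
  exact Complex.conjCLE.contDiff.comp
    (((EuclideanSpace.proj i : C3 →L[ℂ] ℂ).restrictScalars ℝ).contDiff.comp hu)

lemma pd_conj {f : R3 → ℂ} {x : R3} (hf : DifferentiableAt ℝ f x) (j : Fin 3) :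
    pd (fun y => conj (f y)) j x = conj (pd f j x) := by
  have := (Complex.conjCLE.toContinuousLinearMap.hasFDerivAt (x := f x)).comp x hf.hasFDerivAt
  simp only [pd]
  rw [show (fun y => conj (f y)) = Complex.conjCLE.toContinuousLinearMap ∘ f from rfl, this.fderiv]
  simp

lemma curl_conjField {φ : R3 → C3} (hφ : ContDiff ℝ ∞ φ) (x : R3) :
    curl (conjField φ) x = conjField (curl φ) x := by
  have hd : DifferentiableAt ℝ φ x := (hφ.differentiable (by simp)).differentiableAt
  have hd' : DifferentiableAt ℝ (conjField φ) x :=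
    ((contDiff_conjField hφ).differentiable (by simp)).differentiableAt
  have hi : ∀ i, DifferentiableAt ℝ (fun y => φ y i) x := fun i =>
    (((EuclideanSpace.proj i : C3 →L[ℂ] ℂ).restrictScalars ℝ).differentiableAt).comp x hd
  have key : ∀ j i, pderiv (conjField φ) j i x = conj (pderiv φ j i x) := fun j i => by
    rw [pderiv_eq_pd hd', pderiv_eq_pd hd, ← pd_conj (hi i)]
    rfl
  ext i
  fin_cases i <;> simp [curl, conjField, key]

/-- Distributions are paired bilinearly here, so energy densities such as `μH · H̄` arise only after
conjugating one of the two fields. -/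
lemma HasDistribCurl.conjField {u w : R3 → C3} (h : HasDistribCurl u w) :
    HasDistribCurl (conjField u) (conjField w) := by
  intro φ hφ hφs
  have hs : HasCompactSupport (MaxwellDiffraction.conjField φ) := by
    refine HasCompactSupport.intro hφs.isCompact fun x hx => ?_
    ext i
    simp [conjField_apply, image_eq_zero_of_notMem_tsupport hx]
  have := congrArg conj (h _ (contDiff_conjField hφ) hs)
  rw [← integral_conj, ← integral_conj] at this
  simpa [curl_conjField hφ, conjField_apply] using this

lemma pd_mollify {ρ : R3 → ℝ} (hρ : ContDiff ℝ ∞ ρ) (hρs : HasCompactSupport ρ) {q : R3 → ℂ}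
    (hq : L2Loc q) (j : Fin 3) (x : R3) :
    pd (mollify ρ q) j x = ∫ t, pd ρ j (x - t) • q t := by
  have h := hρs.hasFDerivAt_convolution_left (ContinuousLinearMap.lsmul ℝ ℝ)
    (hρ.of_le (by simp)) hq.locallyIntegrable x
  have hi : ConvolutionExistsAt (fderiv ℝ ρ) q x
      ((ContinuousLinearMap.lsmul ℝ ℝ).precompL R3) volume :=
    (hρs.fderiv ℝ).convolutionExists_left _ (hρ.continuous_fderiv (by simp))
      hq.locallyIntegrable x
  have hi' := hi.integrable_swap
  simp only [pd, mollify]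
  rw [h.fderiv, convolution_eq_swap, ContinuousLinearMap.integral_apply hi']
  simp

lemma pd_comp_const_sub {f : R3 → ℝ} (hf : ContDiff ℝ ∞ f) (x t : R3) (j : Fin 3) :
    pd (fun t => ((f (x - t) : ℝ) : ℂ)) j t = ((-pd f j (x - t) : ℝ) : ℂ) := by
  have hd : Differentiable ℝ f := hf.differentiable (by simp)
  have h : HasFDerivAt (fun t => f (x - t)) (-fderiv ℝ f (x - t)) t := by
    have := (hd (x - t)).hasFDerivAt.comp t ((hasFDerivAt_id t).const_sub x)
    refine this.congr_fderiv ?_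
    ext v
    simp
  rw [pd_ofReal h.differentiableAt]
  simp [pd, h.fderiv]

/-- Mollification commutes with the curl. -/
lemma HasDistribCurl.mollify {v z : R3 → C3} (h : HasDistribCurl v z) (hv : MemL2Loc v)
    {ρ : R3 → ℝ} (hρ : ContDiff ℝ ∞ ρ) (hρs : HasCompactSupport ρ) (x : R3) :
    pd (mollify ρ fun x => v x 2) 1 x - pd (mollify ρ fun x => v x 1) 2 x
        = mollify ρ (fun x => z x 0) x ∧
    pd (mollify ρ fun x => v x 0) 2 x - pd (mollify ρ fun x => v x 2) 0 x
        = mollify ρ (fun x => z x 1) x ∧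
    pd (mollify ρ fun x => v x 1) 0 x - pd (mollify ρ fun x => v x 0) 1 x
        = mollify ρ (fun x => z x 2) x := by
  -- The equation is tested with `t ↦ ρ (x - t)` placed in one component at a time.
  have hψ : ContDiff ℝ ∞ fun t => ((ρ (x - t) : ℝ) : ℂ) :=
    Complex.ofRealCLM.contDiff.comp (hρ.comp (contDiff_const.sub contDiff_id))
  have hψs : HasCompactSupport fun t => ((ρ (x - t) : ℝ) : ℂ) :=
    (hρs.comp_homeomorph (Homeomorph.subLeft x)).comp_left Complex.ofReal_zero
  have h0 : ContDiff ℝ ∞ fun _ : R3 => (0 : ℂ) := contDiff_const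
  have h0s : HasCompactSupport fun _ : R3 => (0 : ℂ) := HasCompactSupport.zero
  have hpd0 : ∀ j t, pd (fun _ : R3 => (0 : ℂ)) j t = 0 := fun j t => by simp [pd]
  have hint : ∀ i j, Integrable fun t => pd ρ j (x - t) • v t i := fun i j =>
    ((hasCompactSupport_pd hρs j).convolutionExists_left (ContinuousLinearMap.lsmul ℝ ℝ)
      (contDiff_pd hρ j).continuous (hv.component i).locallyIntegrable x).integrable_swap
  have e0 := h.test hψ h0 h0 hψs h0s h0s
  have e1 := h.test h0 hψ h0 h0s hψs h0s
  have e2 := h.test h0 h0 hψ h0s h0s hψs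
  simp only [hpd0, pd_comp_const_sub hρ] at e0 e1 e2
  simp only [pd_mollify hρ hρs (hv.component _), mollify_eq_swap]
  refine ⟨?_, ?_, ?_⟩
  · rw [← integral_sub (hint _ _) (hint _ _)]
    refine (integral_congr_ae (Eventually.of_forall fun t => ?_)).trans
      (e0.trans (integral_congr_ae (Eventually.of_forall fun t => ?_))) <;> simp <;> ring
  · rw [← integral_sub (hint _ _) (hint _ _)]
    refine (integral_congr_ae (Eventually.of_forall fun t => ?_)).trans
      (e1.trans (integral_congr_ae (Eventually.of_forall fun t => ?_))) <;> simp <;> ring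
  · rw [← integral_sub (hint _ _) (hint _ _)]
    refine (integral_congr_ae (Eventually.of_forall fun t => ?_)).trans
      (e2.trans (integral_congr_ae (Eventually.of_forall fun t => ?_))) <;> simp <;> ring

/-- Integration by parts for the curl of two fields in `L²_loc` with curls in `L²_loc`. -/
lemma HasDistribCurl.integral_by_parts {u w v z : R3 → C3} (huw : HasDistribCurl u w)
    (hvz : HasDistribCurl v z) (hu : MemL2Loc u) (hw : MemL2Loc w) (hv : MemL2Loc v)
    (hz : MemL2Loc z) {χ : R3 → ℝ} (hχ : ContDiff ℝ ∞ χ) (hχs : HasCompactSupport χ) :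
    let f : R3 → ℂ := fun x => (u x 1 * pd χ 2 x - u x 2 * pd χ 1 x - χ x * w x 0) * v x 0
      + (u x 2 * pd χ 0 x - u x 0 * pd χ 2 x - χ x * w x 1) * v x 1
      + (u x 0 * pd χ 1 x - u x 1 * pd χ 0 x - χ x * w x 2) * v x 2
      + χ x * (u x 0 * z x 0 + u x 1 * z x 1 + u x 2 * z x 2)
    Integrable f ∧ ∫ x, f x = 0 := by
  intro f
  have hχc : Continuous fun x => ((χ x : ℝ) : ℂ) := Complex.continuous_ofReal.comp hχ.continuous
  have hχcs : HasCompactSupport fun x => ((χ x : ℝ) : ℂ) := hχs.comp_left Complex.ofReal_zero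
  have hdc : ∀ j, Continuous fun x => ((pd χ j x : ℝ) : ℂ) := fun j =>
    Complex.continuous_ofReal.comp (contDiff_pd hχ j).continuous
  have hdcs : ∀ j, HasCompactSupport fun x => ((pd χ j x : ℝ) : ℂ) := fun j =>
    (hasCompactSupport_pd hχs j).comp_left Complex.ofReal_zero
  -- `f` is `u · curl (χ v) - w · (χ v)` expanded by `curl (χ v) = ∇χ × v + χ z`. It is regrouped as
  -- six products of a compactly supported factor from `u`, `w`, `χ` with a component of `v` or `z`.
  let P : Fin 3 → Fin 3 → Fin 3 → R3 → ℂ := fun i j k x =>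
    pd χ k x * u x j - pd χ j x * u x k - χ x * w x i
  have hP : ∀ i j k, L2Loc (P i j k) := fun i j k =>
    (((hu.component j).test_mul (hdc k) (hdcs k)).sub
      ((hu.component k).test_mul (hdc j) (hdcs j))).sub ((hw.component i).test_mul hχc hχcs)
  have hPs : ∀ i j k, HasCompactSupport (P i j k) := fun i j k => by
    refine HasCompactSupport.intro hχs.isCompact fun x hx => ?_
    have h : ∀ j, pd χ j x = 0 := fun j => by
      simp [pd, fderiv_of_notMem_tsupport ℝ hx]
    simp [P, h, image_eq_zero_of_notMem_tsupport hx]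
  have hQ : ∀ i, L2Loc fun x => χ x * u x i := fun i => (hu.component i).test_mul hχc hχcs
  have hQs : ∀ i, HasCompactSupport fun x => χ x * u x i := fun i => hχcs.mul_right
  let p : Fin 6 → R3 → ℂ := ![P 0 1 2, P 1 2 0, P 2 0 1, fun x => χ x * u x 0,
    fun x => χ x * u x 1, fun x => χ x * u x 2]
  let q : Fin 6 → R3 → ℂ := ![fun x => v x 0, fun x => v x 1, fun x => v x 2, fun x => z x 0,
    fun x => z x 1, fun x => z x 2]
  have hp : ∀ a, L2Loc (p a) := fun a => by
    fin_cases a; exacts [hP _ _ _, hP _ _ _, hP _ _ _, hQ _, hQ _, hQ _]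
  have hps : ∀ a, HasCompactSupport (p a) := fun a => by
    fin_cases a; exacts [hPs _ _ _, hPs _ _ _, hPs _ _ _, hQs _, hQs _, hQs _]
  have hq : ∀ a, L2Loc (q a) := fun a => by
    fin_cases a
    exacts [hv.component 0, hv.component 1, hv.component 2, hz.component 0, hz.component 1,
      hz.component 2]
  have hf : f = fun x => ∑ a, p a x * q a x := by
    funext x
    simp [Fin.sum_univ_six, P, p, q, f]
    ring
  rw [hf]
  refine ⟨integrable_finsetSum _ fun a _ => (hp a).integrable_mul (hps a) (hq a),
    integral_sum_mul_eq_zero_of_mollify hp hps hq ?_⟩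
  intro ρ hρ hρs
  -- After mollifying `v` and `z`, the field `χ (ρ ⋆ v)` is an admissible test field for `u`, and `ρ
  -- ⋆ z` is the classical curl of `ρ ⋆ v`.
  have hm := fun i => contDiff_mollify hρ hρs (hv.component i)
  have hf : ∀ i, ContDiff ℝ ∞ fun x => χ x • MaxwellDiffraction.mollify ρ (fun x => v x i) x :=
    fun i => hχ.smul (hm i)
  have hfs : ∀ i, HasCompactSupport
      fun x => χ x • MaxwellDiffraction.mollify ρ (fun x => v x i) x := fun i => hχs.smul_right
  have hpd : ∀ i j x, pd (fun x => χ x • MaxwellDiffraction.mollify ρ (fun x => v x i) x) j x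
      = pd χ j x • MaxwellDiffraction.mollify ρ (fun x => v x i) x
        + χ x • pd (MaxwellDiffraction.mollify ρ (fun x => v x i)) j x := fun i j x =>
    pd_smul ((hχ.differentiable (by simp)) x) (((hm i).differentiable (by simp)) x)
  have e := huw.test (hf 0) (hf 1) (hf 2) (hfs 0) (hfs 1) (hfs 2)
  have hzc : ∀ i, Continuous (MaxwellDiffraction.mollify ρ (fun x => v x i)) :=
    fun i => (hm i).continuous
  rw [← sub_eq_zero, ← integral_sub] at e
  · rw [← e]
    refine integral_congr_ae (Eventually.of_forall fun x => ?_)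
    obtain ⟨m0, m1, m2⟩ := hvz.mollify hv hρ hρs x
    simp only [Fin.sum_univ_six, P, p, q, hpd]
    simp [← m0, ← m1, ← m2]
    ring
  · have hc : ∀ i j, Continuous
        (pd (fun x => χ x • MaxwellDiffraction.mollify ρ (fun x => v x i) x) j) := fun i j =>
      (contDiff_pd (hf i) j).continuous
    have hs : ∀ i j, HasCompactSupport
        (pd (fun x => χ x • MaxwellDiffraction.mollify ρ (fun x => v x i) x) j) := fun i j =>
      hasCompactSupport_pd (hfs i) j
    exact (((hu.component 0).integrable_mul_test ((hc 2 1).sub (hc 1 2)) ((hs 2 1).sub (hs 1 2))).add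
      ((hu.component 1).integrable_mul_test ((hc 0 2).sub (hc 2 0)) ((hs 0 2).sub (hs 2 0)))).add
      ((hu.component 2).integrable_mul_test ((hc 1 0).sub (hc 0 1)) ((hs 1 0).sub (hs 0 1)))
  · exact (((hw.component 0).integrable_mul_test (hf 0).continuous (hfs 0)).add
      ((hw.component 1).integrable_mul_test (hf 1).continuous (hfs 1))).add
      ((hw.component 2).integrable_mul_test (hf 2).continuous (hfs 2))

/-! ### Radial cutoffs at scale `R`. -/

lemma contDiff_radial {F : ℝ → ℝ} (hF : ContDiff ℝ ∞ F) (a : R3) :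
    ContDiff ℝ ∞ fun x : R3 => F (‖x - a‖ ^ 2) :=
  hF.comp ((contDiff_id.sub contDiff_const).norm_sq ℝ)

lemma pd_radial {F : ℝ → ℝ} (hF : Differentiable ℝ F) (a : R3) (j : Fin 3) (x : R3) :
    pd (fun x : R3 => F (‖x - a‖ ^ 2)) j x = 2 * (x j - a j) * deriv F (‖x - a‖ ^ 2) := by
  have h1 := (hasStrictFDerivAt_norm_sq (x - a)).hasFDerivAt.comp x ((hasFDerivAt_id x).sub_const a)
  have h2 := (hF (‖x - a‖ ^ 2)).hasDerivAt.comp_hasFDerivAt x h1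
  simp only [pd]
  rw [show (fun x : R3 => F (‖x - a‖ ^ 2)) =
    F ∘ ((fun x : R3 => ‖x‖ ^ 2) ∘ fun x => id x - a) from rfl, h2.fderiv]
  simp [EuclideanSpace.inner_single_right]
  ring

/-- A bump function on the line, equal to `1` on `[1/4, 9]` and supported in `[1/8, 73/8]`. -/
def annulusBump : ContDiffBump (37 / 8 : ℝ) := ⟨35 / 8, 9 / 2, by norm_num, by norm_num⟩

lemma annulusBump_eq_one {s : ℝ} (h1 : 1 / 4 ≤ s) (h2 : s ≤ 9) : annulusBump s = 1 := by
  refine annulusBump.one_of_mem_closedBall ?_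
  rw [Metric.mem_closedBall, Real.dist_eq, abs_le]
  constructor <;> simp only [annulusBump] <;> linarith

lemma annulusBump_eq_zero {s : ℝ} (h : s ≤ 1 / 8 ∨ 73 / 8 ≤ s) : annulusBump s = 0 := by
  refine annulusBump.zero_of_le_dist ?_
  rw [Real.dist_eq, le_abs]
  rcases h with h | h
  · right; simp only [annulusBump]; linarith
  · left; simp only [annulusBump]; linarith

/-- A smooth cutoff of the line: constant on `(-∞, 1/8]`, zero on `[10, ∞)`. -/
def cutoff (s : ℝ) : ℝ := ∫ t in s..10, annulusBump t

lemma hasDerivAt_cutoff (s : ℝ) : HasDerivAt cutoff (-annulusBump s) s :=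
  intervalIntegral.integral_hasDerivAt_left (annulusBump.continuous.intervalIntegrable _ _)
    (annulusBump.continuous.stronglyMeasurableAtFilter _ _) annulusBump.continuous.continuousAt

lemma deriv_cutoff : deriv cutoff = fun s => -annulusBump s :=
  funext fun s => (hasDerivAt_cutoff s).deriv

lemma contDiff_cutoff : ContDiff ℝ ∞ cutoff := by
  rw [contDiff_infty_iff_deriv, deriv_cutoff]
  exact ⟨fun s => (hasDerivAt_cutoff s).differentiableAt, annulusBump.contDiff.neg⟩

lemma cutoff_eq_zero {s : ℝ} (hs : 10 ≤ s) : cutoff s = 0 := by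
  rw [cutoff, intervalIntegral.integral_symm, intervalIntegral.integral_zero_ae, neg_zero]
  refine Eventually.of_forall fun t ht => annulusBump_eq_zero (Or.inr ?_)
  rw [Set.uIoc_of_le hs] at ht
  linarith [ht.1]

lemma cutoff_eq {s : ℝ} (hs : s ≤ 1 / 8) : cutoff s = cutoff 0 := by
  have h : ∀ s : ℝ, s ≤ 1 / 8 → cutoff s = cutoff (1 / 8) := fun s hs => by
    rw [cutoff, ← intervalIntegral.integral_add_adjacent_intervals
      (annulusBump.continuous.intervalIntegrable s (1 / 8))
      (annulusBump.continuous.intervalIntegrable (1 / 8) 10), ← cutoff,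
      intervalIntegral.integral_zero_ae, zero_add]
    refine Eventually.of_forall fun t ht => annulusBump_eq_zero (Or.inl ?_)
    rw [Set.uIoc_of_le hs] at ht
    exact ht.2
  rw [h s hs, h 0 (by norm_num)]

lemma cutoff_zero_pos : 0 < cutoff 0 := by
  refine intervalIntegral.integral_pos (by norm_num) annulusBump.continuous.continuousOn
    (fun _ _ => annulusBump.nonneg) ⟨1, by norm_num, ?_⟩
  rw [annulusBump_eq_one] <;> norm_num

/-- The cutoff at scale `R`. -/
def cutoffAt (R : ℝ) (x : R3) : ℝ := cutoff (‖x‖ ^ 2 / R ^ 2)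

/-- The density `G` such that `∇ (cutoffAt R) x = - G x • x`. -/
def cutoffGrad (R : ℝ) (x : R3) : ℝ := 2 * annulusBump (‖x‖ ^ 2 / R ^ 2) / R ^ 2

lemma contDiff_cutoffAt (R : ℝ) : ContDiff ℝ ∞ (cutoffAt R) :=
  contDiff_cutoff.comp ((contDiff_norm_sq ℝ).div_const _)

lemma hasCompactSupport_cutoffAt {R : ℝ} (hR : 0 < R) : HasCompactSupport (cutoffAt R) := by
  refine HasCompactSupport.intro (isCompact_closedBall (0 : R3) (4 * R)) fun x hx => ?_
  rw [mem_closedBall_zero_iff, not_le] at hx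
  refine cutoff_eq_zero ?_
  rw [le_div_iff₀ (by positivity)]
  nlinarith

lemma pd_cutoffAt (R : ℝ) (j : Fin 3) (x : R3) :
    pd (cutoffAt R) j x = -(cutoffGrad R x * x j) := by
  have hs : ∀ s, HasDerivAt (fun s => cutoff (s / R ^ 2)) (-annulusBump (s / R ^ 2) * (1 / R ^ 2))
      s := fun s => HasDerivAt.comp (h₂ := cutoff) s (hasDerivAt_cutoff (s / R ^ 2))
        ((hasDerivAt_id s).div_const _)
  have h := pd_radial (fun s => (hs s).differentiableAt) 0 j x
  simp only [sub_zero, (hs _).deriv] at h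
  change pd (fun x => cutoff (‖x‖ ^ 2 / R ^ 2)) j x = _
  rw [h, cutoffGrad]
  simp
  ring

lemma cutoffGrad_nonneg (R : ℝ) (x : R3) : 0 ≤ cutoffGrad R x :=
  div_nonneg (mul_nonneg zero_le_two annulusBump.nonneg) (sq_nonneg _)

lemma cutoffGrad_le (R : ℝ) (x : R3) : cutoffGrad R x ≤ 2 / R ^ 2 := by
  refine div_le_div_of_nonneg_right ?_ (sq_nonneg _)
  linarith [annulusBump.le_one (x := ‖x‖ ^ 2 / R ^ 2)]

lemma cutoffGrad_of_mem {R : ℝ} (hR : 0 < R) {x : R3} (h1 : R / 2 ≤ ‖x‖) (h2 : ‖x‖ ≤ 3 * R) :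
    cutoffGrad R x = 2 / R ^ 2 := by
  rw [cutoffGrad, annulusBump_eq_one, mul_one]
  · rw [le_div_iff₀ (by positivity)]; nlinarith
  · rw [div_le_iff₀ (by positivity)]; nlinarith [norm_nonneg x]

lemma norm_mem_of_cutoffGrad_ne_zero {R : ℝ} (hR : 0 < R) {x : R3} (h : cutoffGrad R x ≠ 0) :
    R ^ 2 / 8 < ‖x‖ ^ 2 ∧ ‖x‖ ≤ 4 * R := by
  have hb : annulusBump (‖x‖ ^ 2 / R ^ 2) ≠ 0 := fun h0 => h (by simp [cutoffGrad, h0])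
  constructor
  · by_contra! hc
    refine hb (annulusBump_eq_zero (Or.inl ?_))
    rw [div_le_iff₀ (by positivity)]; linarith
  · by_contra! hc
    refine hb (annulusBump_eq_zero (Or.inr ?_))
    rw [le_div_iff₀ (by positivity)]; nlinarith

/-! ### Absorption and energy flux. -/

/-- The absorbed power density `Im (A u · ū)`. -/
def absorption (A : Matrix (Fin 3) (Fin 3) ℂ) (v : C3) : ℝ :=
  (∑ i, (A *ᵥ v.ofLp) i * conj (v i)).im

/-- For symmetric `A` both the real and the imaginary part of `A` give real Hermitian forms, so only
`Im A` contributes, and it acts separately on the real and imaginary parts of `v`. -/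
lemma absorption_eq {A : Matrix (Fin 3) (Fin 3) ℂ} (hA : A.IsSymm) (v : C3) :
    absorption A v = (fun i => (v i).re) ⬝ᵥ (A.map Complex.im *ᵥ fun i => (v i).re)
      + (fun i => (v i).im) ⬝ᵥ (A.map Complex.im *ᵥ fun i => (v i).im) := by
  have h10 := hA.apply 0 1
  have h20 := hA.apply 0 2
  have h21 := hA.apply 1 2
  simp only [absorption, Matrix.mulVec, dotProduct, Fin.sum_univ_three, Matrix.map_apply, h10, h20,
    h21, Complex.add_im, Complex.mul_im, Complex.add_re, Complex.mul_re, Complex.conj_re,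
    Complex.conj_im]
  ring

lemma absorption_pos {A : Matrix (Fin 3) (Fin 3) ℂ} (hA : A.IsSymm)
    (hA' : (A.map Complex.im).PosDef) {v : C3} (hv : v ≠ 0) : 0 < absorption A v := by
  rw [absorption_eq hA]
  have hnn : ∀ y : Fin 3 → ℝ, 0 ≤ y ⬝ᵥ (A.map Complex.im *ᵥ y) := fun y => by
    by_cases hy : y = 0
    · simp [hy]
    · simpa using (hA'.dotProduct_mulVec_pos hy).le
  have hpos : ∀ y : Fin 3 → ℝ, y ≠ 0 → 0 < y ⬝ᵥ (A.map Complex.im *ᵥ y) := fun y hy => by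
    simpa using hA'.dotProduct_mulVec_pos hy
  by_cases hre : (fun i => (v i).re) = 0
  · refine add_pos_of_nonneg_of_pos (hnn _) (hpos _ fun him => hv ?_)
    ext i
    exact Complex.ext (congrFun hre i) (congrFun him i)
  · exact add_pos_of_pos_of_nonneg (hpos _ hre) (hnn _)

lemma absorption_one (v : C3) : absorption 1 v = 0 := by
  simp [absorption, Fin.sum_univ_three]
  ring

/-- The form `εE · Ē` is real for real symmetric `ε`, and it is multiplied by an imaginary number:
the dielectric is lossless. -/
lemma re_dielectric_eq_zero {A : Matrix (Fin 3) (Fin 3) ℝ} (hA : A.IsSymm) (α : ℝ) (v : C3) :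
    (∑ i, v i * conj ((-Complex.I * α) * (A.map Complex.ofReal *ᵥ v.ofLp) i)).re = 0 := by
  have h10 := hA.apply 0 1
  have h20 := hA.apply 0 2
  have h21 := hA.apply 1 2
  simp only [Matrix.mulVec, dotProduct, Fin.sum_univ_three, Matrix.map_apply, h10, h20,
    h21, Complex.add_im, Complex.mul_im, Complex.add_re, Complex.mul_re, Complex.conj_re,
    Complex.conj_im, Complex.neg_re, Complex.neg_im, Complex.I_re, Complex.I_im, Complex.ofReal_re,
    Complex.ofReal_im]
  ring

lemma re_inner_radialCross {x : R3} (e h : C3) :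
    ‖x‖ * (∑ i, radialCross x e i * conj (h i)).re
      = ((x 1 * e 2 - x 2 * e 1) * conj (h 0) + (x 2 * e 0 - x 0 * e 2) * conj (h 1)
        + (x 0 * e 1 - x 1 * e 0) * conj (h 2)).re := by
  by_cases hx : x = 0
  · simp [hx]
  · have hn : (‖x‖ : ℂ) ≠ 0 := by simpa using hx
    rw [← Complex.re_ofReal_mul]
    congr 1
    simp [radialCross, Fin.sum_univ_three, crossProduct]
    field_simp

/-- Pairing `α r = s + k h` with `h` gives `α Re⟨h, r⟩ = k|h|² + Re⟨h, s⟩`. Young's inequality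
absorbs half of `k|h|²`. -/
lemma flux_lower_bound {α k : ℝ} (hα : 0 < α) (hk : 0 < k) (r h s : C3)
    (hs : s = (α : ℂ) • r - (k : ℂ) • h) :
    k / (2 * α) * ‖h‖ ^ 2 - 1 / (2 * α * k) * ‖s‖ ^ 2 ≤ (∑ i, r i * conj (h i)).re := by
  have h1 : (∑ i, r i * conj (h i)) = inner ℂ h r := by
    simp [PiLp.inner_apply]
  have h2 : (α : ℂ) • r = s + (k : ℂ) • h := by rw [hs]; abel
  have h3 : α * (inner ℂ h r).re = (inner ℂ h s).re + k * ‖h‖ ^ 2 := by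
    have := congrArg (fun z => (inner ℂ h z).re) h2
    simp only [inner_smul_right, inner_add_right, Complex.re_ofReal_mul, Complex.add_re] at this
    rw [this, inner_self_eq_norm_sq_to_K]
    norm_cast
  have h4 : -(‖h‖ * ‖s‖) ≤ (inner ℂ h s).re := by
    have := (Complex.abs_re_le_norm (inner ℂ h s)).trans (norm_inner_le_norm h s)
    exact (abs_le.1 this).1
  have h5 : k * (2 * (‖h‖ * ‖s‖)) ≤ k * (k * ‖h‖ ^ 2) + ‖s‖ ^ 2 := by
    nlinarith [sq_nonneg (k * ‖h‖ - ‖s‖)]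
  rw [h1, ← sub_nonneg]
  have h6 : (inner ℂ h r).re - (k / (2 * α) * ‖h‖ ^ 2 - 1 / (2 * α * k) * ‖s‖ ^ 2)
      = (2 * k * (α * (inner ℂ h r).re) - k ^ 2 * ‖h‖ ^ 2 + ‖s‖ ^ 2) / (2 * α * k) := by
    field_simp
    ring
  rw [h6, h3]
  refine div_nonneg ?_ (by positivity)
  nlinarith

/-! ### The energy identity and its consequences. -/

lemma memL2Loc_applyTensor {Ω : Set R3} (hΩ : MeasurableSet Ω) (A : Matrix (Fin 3) (Fin 3) ℂ)
    {u : R3 → C3} (hu : MemL2Loc u) : MemL2Loc (applyTensor (tensorField Ω A) u) := by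
  classical
  intro K hK
  have h1 : MemLp (fun x => Matrix.toEuclideanCLM (𝕜 := ℂ) A (u x)) 2 (volume.restrict K) :=
    (Matrix.toEuclideanCLM (𝕜 := ℂ) A : C3 →L[ℂ] C3).comp_memLp' (hu K hK)
  have := MemLp.piecewise (p := 2) (μ := volume.restrict K) hΩ (h1.mono_measure Measure.restrict_le_self)
    ((hu K hK).mono_measure Measure.restrict_le_self)
  refine (memLp_congr_ae (Eventually.of_forall fun x => ?_)).1 this
  by_cases hx : x ∈ Ω
  · simp only [applyTensor, tensorField, hx, if_true, Set.piecewise_eq_of_mem]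
    rfl
  · simp [applyTensor, tensorField, hx]

lemma MemL2Loc.const_smul {u : R3 → C3} (hu : MemL2Loc u) (c : ℂ) : MemL2Loc fun x => c • u x :=
  fun K hK => (hu K hK).const_smul c

lemma MemL2Loc.conjField {u : R3 → C3} (hu : MemL2Loc u) : MemL2Loc (conjField u) := fun K hK =>
  MemLp.of_eval_piLp fun i => (hu.component i).star K hK

lemma exists_ae_of_eventually_aeInfinity {P : R3 → Prop} (h : ∀ᶠ x in aeInfinity, P x) :
    ∃ r : ℝ, ∀ᵐ x ∂(volume : Measure R3), r ≤ ‖x‖ → P x := by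
  obtain ⟨s, hs, t, ht, hst⟩ := mem_inf_iff_superset.1 h
  obtain ⟨r, -, hr⟩ := hasBasis_cobounded_norm.mem_iff.1 hs
  refine ⟨r, ?_⟩
  filter_upwards [ht] with x hx hrx
  exact hst ⟨hr hrx, hx⟩

/-- The spherical shell `R/2 ≤ |x| ≤ 3R`. -/
def shell (R : ℝ) : Set R3 := {x | R / 2 ≤ ‖x‖ ∧ ‖x‖ ≤ 3 * R}

lemma isCompact_shell (R : ℝ) : IsCompact (shell R) := by
  refine (isCompact_closedBall (0 : R3) (3 * R)).of_isClosed_subset ?_ fun x hx => by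
    simpa using hx.2
  exact (isClosed_le continuous_const continuous_norm).inter
    (isClosed_le continuous_norm continuous_const)

lemma MemL2Loc.integrableOn_norm_sq {u : R3 → C3} (hu : MemL2Loc u) {K : Set R3}
    (hK : IsCompact K) : IntegrableOn (fun x => ‖u x‖ ^ 2) K :=
  (hu K hK).integrable_norm_pow (by simp)

lemma MemL2Loc.integrableOn_absorption {u : R3 → C3} (hu : MemL2Loc u)
    (A : Matrix (Fin 3) (Fin 3) ℂ) {K : Set R3} (hK : IsCompact K) :
    IntegrableOn (fun x => absorption A (u x)) K := by
  refine Integrable.im (𝕜 := ℂ) (f := fun x => ∑ i, (A *ᵥ (u x).ofLp) i * conj (u x i)) ?_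
  refine integrable_finsetSum _ fun i _ => MemLp.integrable_mul (p := 2) (q := 2) ?_ ?_
  · simp only [Matrix.mulVec, dotProduct]
    exact memLp_finsetSum _ fun j _ => (hu.component j K hK).const_mul (A i j)
  · exact (hu.component i).star K hK

/-- This is the real part of the integration by parts for `E` and `H̄`. The cutoff is radial, so its
gradient produces exactly the cross product `x ∧ E` of the radiation condition, and integrating over
a thick shell avoids traces on spheres. -/
lemma energy_identity {α β : ℝ} {Ω : Set R3} (hΩ : MeasurableSet Ω)
    {εeff : Matrix (Fin 3) (Fin 3) ℝ} (hε : εeff.IsSymm) {μeff : Matrix (Fin 3) (Fin 3) ℂ}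
    {E H : R3 → C3} (hE : MemL2Loc E) (hH : MemL2Loc H)
    (curl_E : HasDistribCurl E fun x =>
      (Complex.I * β) • applyTensor (tensorField Ω μeff) H x)
    (curl_H : HasDistribCurl H fun x =>
      (-Complex.I * α) • applyTensor (tensorField Ω (εeff.map Complex.ofReal)) E x)
    {R : ℝ} (hR : 0 < R) :
    let T : R3 → ℝ := fun x =>
      cutoffGrad R x * (‖x‖ * (∑ i, radialCross x (E x) i * conj (H x i)).re)
        + β * cutoffAt R x * absorption (tensorField Ω μeff x) (H x)
    Integrable T ∧ ∫ x, T x = 0 := by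
  intro T
  have hw := (memL2Loc_applyTensor hΩ μeff hH).const_smul (Complex.I * β)
  have hz := (memL2Loc_applyTensor hΩ (εeff.map Complex.ofReal) hE).const_smul (-Complex.I * α)
  obtain ⟨hi, h0⟩ := curl_E.integral_by_parts curl_H.conjField hE hw hH.conjField hz.conjField
    (contDiff_cutoffAt R) (hasCompactSupport_cutoffAt hR)
  set f : R3 → ℂ := _
  change Integrable f at hi
  have hTf : T = fun x => Complex.reCLM (f x) := by
    funext x
    have hre : (∑ i, E x i * conj ((-Complex.I * α) *
        (tensorField Ω (εeff.map Complex.ofReal) x *ᵥ (E x).ofLp) i)).re = 0 := by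
      by_cases hx : x ∈ Ω
      · simpa [tensorField, hx] using re_dielectric_eq_zero hε α (E x)
      · simpa [tensorField, hx] using re_dielectric_eq_zero
          (Matrix.transpose_one : (1 : Matrix (Fin 3) (Fin 3) ℝ).IsSymm) α (E x)
    have hre' : (cutoffAt R x : ℂ).re * (∑ i, E x i * conj ((-Complex.I * α) *
        (tensorField Ω (εeff.map Complex.ofReal) x *ᵥ (E x).ofLp) i)).re = 0 := by
      rw [hre, mul_zero]
    simp only [T, re_inner_radialCross, absorption]
    rw [← add_zero (_ + _), ← hre']
    simp only [f, pd_cutoffAt, conjField_apply, applyTensor, Fin.sum_univ_three, PiLp.smul_apply,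
      smul_eq_mul, Complex.reCLM_apply, map_mul, map_neg, Complex.conj_I, Complex.conj_ofReal,
      Complex.add_re, Complex.sub_re, Complex.mul_re, Complex.add_im, Complex.sub_im,
      Complex.mul_im, Complex.ofReal_re, Complex.ofReal_im, Complex.ofReal_neg, Complex.neg_re,
      Complex.neg_im, Complex.I_re, Complex.I_im, Complex.conj_re, Complex.conj_im,
      Complex.ofReal_mul]
    ring
  rw [hTf]
  refine ⟨Complex.reCLM.integrable_comp hi, ?_⟩
  rw [Complex.reCLM.integral_comp_comm hi, h0]
  simp

/-- The gradient of the cutoff lives where `|x|² > R²/8`, hence `|x| ≥ R/3`. There `|x| s² ≤ η²/|x|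
≤ 3η²/R`, and the density is at most `2/R²`. -/
lemma cutoffGrad_mul_norm_mul_sq_le {R η s : ℝ} (hR : 0 < R) (hs0 : 0 ≤ s) {x : R3}
    (hs : R ^ 2 / 8 < ‖x‖ ^ 2 → s ≤ η * ‖x‖⁻¹) :
    cutoffGrad R x * (‖x‖ * s ^ 2)
      ≤ (Metric.closedBall (0 : R3) (4 * R)).indicator (fun _ => 6 * η ^ 2 / R ^ 3) x := by
  by_cases hG : cutoffGrad R x = 0
  · rw [hG, zero_mul]
    exact Set.indicator_nonneg (fun _ _ => by positivity) _
  · obtain ⟨h1, h2⟩ := norm_mem_of_cutoffGrad_ne_zero hR hG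
    rw [Set.indicator_of_mem (by simpa using h2)]
    have hx : R / 3 ≤ ‖x‖ := by
      by_contra! h
      nlinarith [norm_nonneg x]
    have hx0 : 0 < ‖x‖ := by linarith
    have h3 : s ^ 2 ≤ (η * ‖x‖⁻¹) ^ 2 := pow_le_pow_left₀ hs0 (hs h1) 2
    have h4 : ‖x‖ * s ^ 2 ≤ η ^ 2 * (3 / R) := by
      calc ‖x‖ * s ^ 2 ≤ ‖x‖ * (η * ‖x‖⁻¹) ^ 2 := by gcongr
        _ = η ^ 2 * ‖x‖⁻¹ := by field_simp
        _ ≤ η ^ 2 * (3 / R) := by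
          gcongr
          rw [inv_le_comm₀ hx0 (by positivity), inv_div]
          exact hx
    calc cutoffGrad R x * (‖x‖ * s ^ 2) ≤ 2 / R ^ 2 * (η ^ 2 * (3 / R)) :=
          mul_le_mul (cutoffGrad_le R x) h4 (by positivity) (by positivity)
      _ = 6 * η ^ 2 / R ^ 3 := by field_simp; ring

/-- Absorption in `Ω` and magnetic energy in large shells are controlled by the defect in the
radiation condition. -/
lemma energy_estimate {α β k : ℝ} (hα : 0 < α) (hk : 0 < k) {Ω : Set R3}
    (hΩ : MeasurableSet Ω) (hΩb : Bornology.IsBounded Ω)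
    {εeff : Matrix (Fin 3) (Fin 3) ℝ} (hε : εeff.IsSymm) {μeff : Matrix (Fin 3) (Fin 3) ℂ}
    {E H : R3 → C3} (hE : MemL2Loc E) (hH : MemL2Loc H)
    (curl_E : HasDistribCurl E fun x =>
      (Complex.I * β) • applyTensor (tensorField Ω μeff) H x)
    (curl_H : HasDistribCurl H fun x =>
      (-Complex.I * α) • applyTensor (tensorField Ω (εeff.map Complex.ofReal)) E x)
    (hS : (fun x => (α : ℂ) • radialCross x (E x) - (k : ℂ) • H x)
      =o[aeInfinity] fun x => ‖x‖⁻¹) {η : ℝ} (hη : 0 < η) :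
    ∀ᶠ R in atTop, β * cutoff 0 * (∫ x in Ω, absorption μeff (H x))
      + k / (2 * α) * (R⁻¹ * ∫ x in shell R, ‖H x‖ ^ 2)
      ≤ 1 / (2 * α * k) * (384 * volume.real (Metric.ball (0 : R3) 1) * η ^ 2) := by
  obtain ⟨r, hr⟩ := exists_ae_of_eventually_aeInfinity (hS.def hη)
  obtain ⟨ρ, hρ⟩ := hΩb.subset_closedBall 0
  -- Since `R²/9 < R²/8`, the bound `R ≥ 3ρ` puts `Ω` where the cutoff equals `cutoff 0`, and `R ≥
  -- 3r` makes the radiation bound valid wherever the gradient is nonzero.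
  filter_upwards [eventually_gt_atTop 0, eventually_ge_atTop (3 * r), eventually_ge_atTop (3 * ρ)]
    with R hR hRr hRρ
  have hΩK : IntegrableOn (fun x => absorption μeff (H x)) Ω :=
    (hH.integrableOn_absorption μeff (isCompact_closedBall 0 ρ)).mono_set hρ
  have hsh := hH.integrableOn_norm_sq (isCompact_shell R)
  obtain ⟨hTi, hT0⟩ := energy_identity hΩ hε hE hH curl_E curl_H hR
  set B : R3 → ℝ := (Metric.closedBall (0 : R3) (4 * R)).indicator fun _ => 6 * η ^ 2 / R ^ 3
  have hBi : Integrable B := by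
    rw [integrable_indicator_iff measurableSet_closedBall]
    exact integrableOn_const (isCompact_closedBall _ _).measure_lt_top.ne
  -- The constant is `384 = 6 · 4³`, from the ball of radius `4R`; the powers of `R` cancel.
  have hBint : ∫ x, B x = 384 * volume.real (Metric.ball (0 : R3) 1) * η ^ 2 := by
    rw [integral_indicator measurableSet_closedBall, setIntegral_const,
      Measure.addHaar_real_closedBall _ _ (by positivity), finrank_euclideanSpace_fin, smul_eq_mul]
    field_simp
    ring
  have hAi := (hΩK.integrable_indicator hΩ).const_mul (β * cutoff 0)
  have hHi := ((hsh.integrable_indicator (isCompact_shell R).measurableSet).const_mul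
    R⁻¹).const_mul (k / (2 * α))
  have hBi' := hBi.const_mul (1 / (2 * α * k))
  have key := integral_mono_ae ((hAi.add hHi).sub hBi') hTi ?_
  · rw [hT0] at key
    simp only [Pi.sub_apply, Pi.add_apply] at key
    rw [integral_sub (by exact hAi.add hHi) hBi', integral_add hAi hHi, integral_const_mul,
      integral_const_mul, integral_const_mul, integral_const_mul, hBint,
      integral_indicator hΩ, integral_indicator (isCompact_shell R).measurableSet] at key
    linarith
  · filter_upwards [hr] with x hx
    simp only [Pi.sub_apply, Pi.add_apply]
    have hfl := mul_le_mul_of_nonneg_left (flux_lower_bound hα hk (radialCross x (E x)) (H x) _ rfl)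
      (mul_nonneg (cutoffGrad_nonneg R x) (norm_nonneg x))
    set s := ‖(α : ℂ) • radialCross x (E x) - (k : ℂ) • H x‖
    have hB : cutoffGrad R x * (‖x‖ * s ^ 2) ≤ B x := by
      refine cutoffGrad_mul_norm_mul_sq_le hR (norm_nonneg _) fun h1 => ?_
      have hx' : r ≤ ‖x‖ := by
        by_contra! h
        nlinarith [norm_nonneg x]
      simpa only [norm_inv, norm_norm] using hx hx'
    have hA : β * cutoff 0 * Ω.indicator (fun x => absorption μeff (H x)) x
        = β * cutoffAt R x * absorption (tensorField Ω μeff x) (H x) := by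
      by_cases hxΩ : x ∈ Ω
      · have hxρ : ‖x‖ ≤ ρ := by simpa using hρ hxΩ
        have : cutoffAt R x = cutoff 0 := cutoff_eq (by
          rw [div_le_iff₀ (by positivity)]
          nlinarith [norm_nonneg x])
        simp [tensorField, hxΩ, this]
      · simp [tensorField, hxΩ, absorption_one]
    -- On the shell the weight is `2|x|/R²`, which is at least `1/R` because `|x| ≥ R/2`.
    have hHs : R⁻¹ * (shell R).indicator (fun x => ‖H x‖ ^ 2) x
        ≤ cutoffGrad R x * (‖x‖ * ‖H x‖ ^ 2) := by
      by_cases hxs : x ∈ shell R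
      · rw [Set.indicator_of_mem hxs, cutoffGrad_of_mem hR hxs.1 hxs.2, ← mul_assoc]
        refine mul_le_mul_of_nonneg_right ?_ (sq_nonneg _)
        have := hxs.1
        rw [inv_eq_one_div, div_mul_eq_mul_div, div_le_div_iff₀ hR (by positivity)]
        nlinarith
      · rw [Set.indicator_of_notMem hxs, mul_zero]
        exact mul_nonneg (cutoffGrad_nonneg R x) (by positivity)
    have hHs' := mul_le_mul_of_nonneg_left hHs (show 0 ≤ k / (2 * α) by positivity)
    have hB' := mul_le_mul_of_nonneg_left hB (show 0 ≤ 1 / (2 * α * k) by positivity)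
    rw [hA]
    nlinarith

/-- The magnetic field vanishes in the absorbing medium. -/
lemma ae_eq_zero_of_energy {c : ℝ} (hc : 0 < c) {Ω : Set R3} (hΩ : MeasurableSet Ω)
    (hΩb : Bornology.IsBounded Ω) {μeff : Matrix (Fin 3) (Fin 3) ℂ} (hμ : μeff.IsSymm)
    (hμ' : (μeff.map Complex.im).PosDef) {H : R3 → C3} (hH : MemL2Loc H)
    (h : ∀ η : ℝ, 0 < η → c * (∫ x in Ω, absorption μeff (H x)) ≤ η) :
    ∀ᵐ x ∂(volume : Measure R3), x ∈ Ω → H x = 0 := by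
  obtain ⟨ρ, hρ⟩ := hΩb.subset_closedBall 0
  have hnn : ∀ v, 0 ≤ absorption μeff v := fun v => by
    by_cases hv : v = 0
    · simp [hv, absorption]
    · exact (absorption_pos hμ hμ' hv).le
  have hi : IntegrableOn (fun x => absorption μeff (H x)) Ω :=
    (hH.integrableOn_absorption μeff (isCompact_closedBall 0 ρ)).mono_set hρ
  have h0 : ∫ x in Ω, absorption μeff (H x) = 0 := by
    refine le_antisymm ?_ (integral_nonneg fun x => hnn _)
    have : c * (∫ x in Ω, absorption μeff (H x)) ≤ 0 := le_of_forall_pos_le_add (by simpa using h)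
    exact nonpos_of_mul_nonpos_right this hc
  rw [integral_eq_zero_iff_of_nonneg (fun x => hnn _) hi, EventuallyEq,
    ae_restrict_iff' hΩ] at h0
  filter_upwards [h0] with x hx hxΩ
  by_contra hne
  exact (absorption_pos hμ hμ' hne).ne' (hx hxΩ)

/-! ### From the vacuum Maxwell system to the Helmholtz equation. -/

/-- A distributional curl is orthogonal to gradients of test functions. -/
lemma HasDistribCurl.integral_mul_grad {u w : R3 → C3} (h : HasDistribCurl u w) {χ : R3 → ℂ}
    (hχ : ContDiff ℝ ∞ χ) (hχs : HasCompactSupport χ) :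
    ∫ x, (w x 0 * pd χ 0 x + w x 1 * pd χ 1 x + w x 2 * pd χ 2 x) = 0 := by
  rw [← h.test (contDiff_pd hχ 0) (contDiff_pd hχ 1) (contDiff_pd hχ 2)
    (hasCompactSupport_pd hχs 0) (hasCompactSupport_pd hχs 1) (hasCompactSupport_pd hχs 2)]
  simp [pd_comm hχ 2 1, pd_comm hχ 2 0, pd_comm hχ 1 0]

lemma pd_zero (j : Fin 3) (x : R3) : pd (fun _ : R3 => (0 : ℂ)) j x = 0 := by
  simp [pd]

lemma pd_neg {f : R3 → ℂ} (j : Fin 3) (x : R3) : pd (fun y => -f y) j x = -pd f j x := by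
  simp [pd, fderiv_fun_neg]

/-- Each component of the magnetic field of a solution of the Maxwell system in vacuum satisfies the
Helmholtz equation in the sense of distributions. -/
lemma helmholtz_of_maxwell {a b : ℂ} (hb : b ≠ 0) {E H : R3 → C3} (hH : MemL2Loc H)
    (curl_E : HasDistribCurl E fun x => b • H x) (curl_H : HasDistribCurl H fun x => a • E x)
    {ψ : R3 → ℂ} (hψ : ContDiff ℝ ∞ ψ) (hψs : HasCompactSupport ψ) (i : Fin 3) :
    ∫ x, H x i * (∑ j, pd (pd ψ j) j x + a * b * ψ x) = 0 := by
  have h0 : ContDiff ℝ ∞ fun _ : R3 => (0 : ℂ) := contDiff_const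
  have h0s : HasCompactSupport fun _ : R3 => (0 : ℂ) := HasCompactSupport.zero
  have hd := contDiff_pd hψ
  have hds := hasCompactSupport_pd hψs
  have hn := fun j => (hd j).neg
  have hns : ∀ j, HasCompactSupport fun x => -pd ψ j x := fun j => (hds j).neg
  have hdd : ∀ i j, Continuous (pd (pd ψ i) j) := fun i j => (contDiff_pd (hd i) j).continuous
  have hdds : ∀ i j, HasCompactSupport (pd (pd ψ i) j) := fun i j => hasCompactSupport_pd (hds i) j
  have hI : ∀ l i j, Integrable fun x => H x l * pd (pd ψ i) j x := fun l i j =>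
    (hH.component l).integrable_mul_test (hdd i j) (hdds i j)
  have hJ : ∀ l, Integrable fun x => H x l * ψ x := fun l =>
    (hH.component l).integrable_mul_test hψ.continuous hψs
  -- `b H` is a curl, so `H` is divergence free. This removes the gradient term in `curl curl = ∇
  -- div - Δ`.
  have hdiv : ∀ i, ∫ x, (H x 0 * pd (pd ψ i) 0 x + H x 1 * pd (pd ψ i) 1 x
      + H x 2 * pd (pd ψ i) 2 x) = 0 := fun i => by
    have h := curl_E.integral_mul_grad (hd i) (hds i)
    simp only [PiLp.smul_apply, smul_eq_mul, mul_assoc, ← mul_add] at h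
    rw [integral_const_mul] at h
    exact (mul_eq_zero.1 h).resolve_left hb
  -- it suffices to test the curl equations with `ψ eᵢ` and `curl (ψ eᵢ)`
  have key : ∀ (F G : R3 → ℂ), Integrable F → ∫ x, F x = ∫ x, a * G x →
      ∫ x, G x = ∫ x, b * (H x i * ψ x) →
      (∀ x, F x = H x 0 * pd (pd ψ i) 0 x + H x 1 * pd (pd ψ i) 1 x + H x 2 * pd (pd ψ i) 2 x
        - H x i * ∑ j, pd (pd ψ j) j x) →
      ∫ x, H x i * (∑ j, pd (pd ψ j) j x + a * b * ψ x) = 0 := by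
    intro F G hF hFG hG hFx
    have hD : Integrable fun x => H x 0 * pd (pd ψ i) 0 x + H x 1 * pd (pd ψ i) 1 x
      + H x 2 * pd (pd ψ i) 2 x := ((hI _ _ _).add (hI _ _ _)).add (hI _ _ _)
    have e : ∀ x, H x i * (∑ j, pd (pd ψ j) j x + a * b * ψ x)
        = (H x 0 * pd (pd ψ i) 0 x + H x 1 * pd (pd ψ i) 1 x + H x 2 * pd (pd ψ i) 2 x - F x)
          + a * b * (H x i * ψ x) := fun x => by
      rw [hFx x]
      ring
    simp only [e]
    rw [integral_add (by exact hD.sub hF) ((hJ i).const_mul _), integral_sub hD hF, hdiv, hFG,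
      integral_const_mul, hG, integral_const_mul, integral_const_mul]
    ring
  have hsub : ∀ l m p q r s, Integrable fun x =>
      H x l * pd (pd ψ p) q x - H x m * pd (pd ψ r) s x := fun l m p q r s =>
    (hI _ _ _).sub (hI _ _ _)
  fin_cases i
  · refine key _ _ ?_ ((curl_H.test h0 (hd 2) (hn 1) h0s (hds 2) (hns 1)).trans ?_)
      ((curl_E.test hψ h0 h0 hψs h0s h0s).trans ?_) fun x => ?_
    · simp only [pd_zero, pd_neg]
      exact ((((hI 0 1 1).add (hI 0 2 2)).neg.add (hI 1 1 0)).add (hI 2 2 0)).congr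
        (Eventually.of_forall fun x => by simp; ring)
    · exact integral_congr_ae (Eventually.of_forall fun x => by simp [pd_zero]; ring)
    · exact integral_congr_ae (Eventually.of_forall fun x => by simp; ring)
    · simp [pd_zero, pd_neg, Fin.sum_univ_three, pd_comm hψ 1 0, pd_comm hψ 2 0]
      ring
  · refine key _ _ ?_ ((curl_H.test (hn 2) h0 (hd 0) (hns 2) h0s (hds 0)).trans ?_)
      ((curl_E.test h0 hψ h0 h0s hψs h0s).trans ?_) fun x => ?_
    · simp only [pd_zero, pd_neg]
      exact ((((hI 1 2 2).add (hI 1 0 0)).neg.add (hI 0 0 1)).add (hI 2 2 1)).congr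
        (Eventually.of_forall fun x => by simp; ring)
    · exact integral_congr_ae (Eventually.of_forall fun x => by simp [pd_zero]; ring)
    · exact integral_congr_ae (Eventually.of_forall fun x => by simp; ring)
    · simp [pd_zero, pd_neg, Fin.sum_univ_three, pd_comm hψ 1 0, pd_comm hψ 2 1]
      ring
  · refine key _ _ ?_ ((curl_H.test (hd 1) (hn 0) h0 (hds 1) (hns 0) h0s).trans ?_)
      ((curl_E.test h0 h0 hψ h0s h0s hψs).trans ?_) fun x => ?_
    · simp only [pd_zero, pd_neg]
      exact ((((hI 2 0 0).add (hI 2 1 1)).neg.add (hI 0 0 2)).add (hI 1 1 2)).congr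
        (Eventually.of_forall fun x => by simp; ring)
    · exact integral_congr_ae (Eventually.of_forall fun x => by simp [pd_zero]; ring)
    · exact integral_congr_ae (Eventually.of_forall fun x => by simp; ring)
    · simp [pd_zero, pd_neg, Fin.sum_univ_three, pd_comm hψ 2 0, pd_comm hψ 2 1]
      ring

/-- If a field vanishes on an open set, so does its curl. -/
lemma HasDistribCurl.ae_eq_zero {u w : R3 → C3} (h : HasDistribCurl u w) (hw : MemL2Loc w)
    {U : Set R3} (hU : IsOpen U) (hu : ∀ᵐ x ∂(volume : Measure R3), x ∈ U → u x = 0) :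
    ∀ᵐ x ∂(volume : Measure R3), x ∈ U → w x = 0 := by
  have h0 : ContDiff ℝ ∞ fun _ : R3 => (0 : ℂ) := contDiff_const
  have h0s : HasCompactSupport fun _ : R3 => (0 : ℂ) := HasCompactSupport.zero
  have key : ∀ i, ∀ᵐ x ∂(volume : Measure R3), x ∈ U → w x i = 0 := by
    intro i
    refine hU.ae_eq_zero_of_integral_contDiff_smul_eq_zero
      ((hw.component i).locallyIntegrable.locallyIntegrableOn U) fun g hg hgs hgU => ?_
    have hψ : ContDiff ℝ ∞ fun t => (g t : ℂ) := Complex.ofRealCLM.contDiff.comp hg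
    have hψs : HasCompactSupport fun t => (g t : ℂ) := hgs.comp_left Complex.ofReal_zero
    have hz : ∀ᵐ x ∂(volume : Measure R3), ∀ l j, u x l * pd (fun t => (g t : ℂ)) j x = 0 := by
      filter_upwards [hu] with x hx l j
      by_cases hxU : x ∈ U
      · simp [hx hxU]
      · have : pd g j x = 0 := by
          simp [pd, fderiv_of_notMem_tsupport ℝ fun hxg => hxU (hgU hxg)]
        simp [pd_ofReal ((hg.differentiable (by simp)) x), this]
    fin_cases i
    · have e := h.test hψ h0 h0 hψs h0s h0s
      rw [integral_eq_zero_of_ae] at e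
      · rw [e]
        exact integral_congr_ae (Eventually.of_forall fun x => by simp [mul_comm])
      · filter_upwards [hz] with x hx
        simp [pd_zero, hx]
    · have e := h.test h0 hψ h0 h0s hψs h0s
      rw [integral_eq_zero_of_ae] at e
      · rw [e]
        exact integral_congr_ae (Eventually.of_forall fun x => by simp [mul_comm])
      · filter_upwards [hz] with x hx
        simp [pd_zero, hx]
    · have e := h.test h0 h0 hψ h0s h0s hψs
      rw [integral_eq_zero_of_ae] at e
      · rw [e]
        exact integral_congr_ae (Eventually.of_forall fun x => by simp [mul_comm])
      · filter_upwards [hz] with x hx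
        simp [pd_zero, hx]
  filter_upwards [ae_all_iff.2 key] with x hx hxU
  ext i
  exact hx i hxU

/-! ### Truncated spherical waves. -/

/-- A smooth step: `0` on `(-∞, 1]` and `1` on `[2, ∞)`. -/
def step (r : ℝ) : ℝ := Real.smoothTransition (r - 1)

lemma contDiff_step : ContDiff ℝ ∞ step :=
  Real.smoothTransition.contDiff.comp (contDiff_id.sub contDiff_const)

lemma step_eq_zero {r : ℝ} (h : r ≤ 1) : step r = 0 :=
  Real.smoothTransition.zero_of_nonpos (by linarith)

lemma step_eq_one {r : ℝ} (h : 2 ≤ r) : step r = 1 :=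
  Real.smoothTransition.one_of_one_le (by linarith)

lemma contDiff_deriv_step : ContDiff ℝ ∞ (deriv step) :=
  (contDiff_infty_iff_deriv.1 contDiff_step).2

lemma contDiff_deriv_deriv_step : ContDiff ℝ ∞ (deriv (deriv step)) :=
  (contDiff_infty_iff_deriv.1 contDiff_deriv_step).2

lemma hasDerivAt_step (r : ℝ) : HasDerivAt step (deriv step r) r :=
  ((contDiff_step.differentiable (by simp)) r).hasDerivAt

lemma hasDerivAt_deriv_step (r : ℝ) : HasDerivAt (deriv step) (deriv (deriv step) r) r :=
  ((contDiff_deriv_step.differentiable (by simp)) r).hasDerivAt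

lemma step_eventuallyEq_const {r : ℝ} (h : r < 1 ∨ 2 < r) : ∃ c : ℝ, step =ᶠ[𝓝 r] fun _ => c := by
  rcases h with h | h
  · exact ⟨0, by filter_upwards [Iio_mem_nhds h] with s hs using step_eq_zero hs.le⟩
  · exact ⟨1, by filter_upwards [Ioi_mem_nhds h] with s hs using step_eq_one hs.le⟩

lemma deriv_step_eq_zero {r : ℝ} (h : r < 1 ∨ 2 < r) : deriv step r = 0 := by
  obtain ⟨c, hc⟩ := step_eventuallyEq_const h
  rw [hc.deriv_eq, deriv_const]

lemma deriv_deriv_step_eq_zero {r : ℝ} (h : r < 1 ∨ 2 < r) : deriv (deriv step) r = 0 := by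
  obtain ⟨c, hc⟩ := step_eventuallyEq_const h
  rw [hc.deriv.deriv_eq]
  simp

lemma exists_bound_of_eq_zero {f : ℝ → ℝ} (hf : Continuous f) (h0 : ∀ r, r < 1 ∨ 2 < r → f r = 0) :
    ∃ C, 0 ≤ C ∧ ∀ r, |f r| ≤ C := by
  have hs : HasCompactSupport f := HasCompactSupport.intro (isCompact_Icc (a := (1 : ℝ)) (b := 2))
    fun r hr => h0 r (by
      by_contra! hc
      exact hr ⟨hc.1, hc.2⟩)
  obtain ⟨C, hC⟩ := hs.exists_bound_of_continuous hf
  exact ⟨C, (norm_nonneg _).trans (hC 0), hC⟩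

/-- The profile `cos (k r) b (r / t)`. -/
def waveProfile (k t r : ℝ) : ℝ := Real.cos (k * r) * step (r / t)

/-- The truncated spherical wave `cos (k r) b (r / t) / r` as a function of `r²`. -/
def wave (k t s : ℝ) : ℝ := waveProfile k t √s / √s

/-- `(Δ + k²)` of the truncated spherical wave, as a function of `r`. -/
def waveSource (k t r : ℝ) : ℝ :=
  (-2 * k * Real.sin (k * r) * (deriv step (r / t) / t)
    + Real.cos (k * r) * (deriv (deriv step) (r / t) / t ^ 2)) / r

/-- The derivative of the profile. -/
def waveProfileDeriv (k t r : ℝ) : ℝ :=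
  -(k * Real.sin (k * r)) * step (r / t) + Real.cos (k * r) * (deriv step (r / t) / t)

lemma hasDerivAt_cos_mul (k r : ℝ) :
    HasDerivAt (fun r => Real.cos (k * r)) (-(k * Real.sin (k * r))) r := by
  refine ((hasDerivAt_id r).const_mul k).cos.congr_deriv ?_
  simp
  ring

lemma hasDerivAt_step_div (t r : ℝ) :
    HasDerivAt (fun r => step (r / t)) (deriv step (r / t) / t) r := by
  have := HasDerivAt.comp (h₂ := step) r (hasDerivAt_step (r / t)) ((hasDerivAt_id r).div_const t)
  refine this.congr_deriv ?_
  ring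

lemma hasDerivAt_waveProfile (k t r : ℝ) :
    HasDerivAt (waveProfile k t) (waveProfileDeriv k t r) r := by
  exact (hasDerivAt_cos_mul k r).mul (hasDerivAt_step_div t r)

lemma hasDerivAt_waveProfileDeriv (k t r : ℝ) :
    HasDerivAt (waveProfileDeriv k t)
      (-2 * k * Real.sin (k * r) * (deriv step (r / t) / t)
        + Real.cos (k * r) * (deriv (deriv step) (r / t) / t ^ 2) - k ^ 2 * waveProfile k t r)
      r := by
  have h1' : HasDerivAt (fun r => -(k * Real.sin (k * r))) (-(k * (k * Real.cos (k * r)))) r := by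
    have := (((hasDerivAt_id r).const_mul k).sin.const_mul k).neg
    refine this.congr_deriv ?_
    simp only [id]
    ring
  have h3 : HasDerivAt (fun r => deriv step (r / t) / t) (deriv (deriv step) (r / t) / t ^ 2) r := by
    have := (HasDerivAt.comp (h₂ := deriv step) r (hasDerivAt_deriv_step (r / t))
      ((hasDerivAt_id r).div_const t)).div_const t
    refine this.congr_deriv ?_
    field_simp
  have := (h1'.mul (hasDerivAt_step_div t r)).add ((hasDerivAt_cos_mul k r).mul h3)
  refine this.congr_deriv ?_
  rw [waveProfile]
  ring

lemma wave_eq_zero {k t s : ℝ} (ht : 0 < t) (hs : s < t ^ 2) : wave k t s = 0 := by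
  have h : √s ≤ t := Real.sqrt_le_iff.2 ⟨ht.le, hs.le⟩
  simp [wave, waveProfile, step_eq_zero ((div_le_one ht).2 h)]

lemma contDiff_waveProfile (k t : ℝ) : ContDiff ℝ ∞ (waveProfile k t) :=
  (Real.contDiff_cos.comp (contDiff_const.mul contDiff_id)).mul
    (contDiff_step.comp (contDiff_id.div_const t))

/-- The truncation makes the function vanish for `s < t²`, away from which the square root is
smooth. -/
lemma contDiff_wave {k t : ℝ} (ht : 0 < t) : ContDiff ℝ ∞ (wave k t) := by
  rw [contDiff_iff_contDiffAt]
  intro s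
  by_cases hs : s < t ^ 2
  · refine (contDiffAt_const (c := (0 : ℝ))).congr_of_eventuallyEq ?_
    filter_upwards [Iio_mem_nhds hs] with r hr using wave_eq_zero ht hr
  · have hs0 : s ≠ 0 := by
      have := pow_pos ht 2
      intro h
      exact hs (h ▸ this)
    have hq : ContDiffAt ℝ ∞ (fun s : ℝ => √s) s := Real.contDiffAt_sqrt hs0
    refine ((contDiff_waveProfile k t).contDiffAt.comp s hq).div hq ?_
    rw [Real.sqrt_ne_zero']
    exact (pow_pos ht 2).trans_le (not_lt.1 hs)

lemma hasDerivAt_wave {k t s : ℝ} (hs : 0 < s) :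
    HasDerivAt (wave k t)
      (waveProfileDeriv k t √s / (2 * √s ^ 2) - waveProfile k t √s / (2 * √s ^ 3)) s := by
  have hq : √s ≠ 0 := (Real.sqrt_pos.2 hs).ne'
  have h := ((hasDerivAt_waveProfile k t √s).comp s (Real.hasDerivAt_sqrt hs.ne')).div
    (Real.hasDerivAt_sqrt hs.ne') hq
  refine h.congr_deriv ?_
  simp only [Function.comp]
  field_simp

/-- In the variable `s = r²` the Laplacian is `4s∂² + 6∂`. On `p(r)/r` it gives `p''(r)/r`, and for
`p = cos(kr) b(r/t)` the term without derivatives of `b` cancels against `k²`. -/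
lemma helmholtz_wave {k t s : ℝ} (hs : 0 < s) :
    4 * s * deriv (deriv (wave k t)) s + 6 * deriv (wave k t) s + k ^ 2 * wave k t s
      = waveSource k t √s := by
  have hq : √s ≠ 0 := (Real.sqrt_pos.2 hs).ne'
  have hd : deriv (wave k t) =ᶠ[𝓝 s] fun s =>
      waveProfileDeriv k t √s / (2 * √s ^ 2) - waveProfile k t √s / (2 * √s ^ 3) := by
    filter_upwards [Ioi_mem_nhds hs] with r hr using (hasDerivAt_wave hr).deriv
  have hsq := Real.hasDerivAt_sqrt hs.ne'
  have h := (((hasDerivAt_waveProfileDeriv k t √s).comp s hsq).div ((hsq.pow 2).const_mul 2)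
    (mul_ne_zero two_ne_zero (pow_ne_zero _ hq))).sub (((hasDerivAt_waveProfile k t √s).comp s hsq).div
      ((hsq.pow 3).const_mul 2) (mul_ne_zero two_ne_zero (pow_ne_zero _ hq)))
  rw [hd.deriv_eq, (hasDerivAt_wave hs).deriv]
  have h' := h.deriv
  simp only [Function.comp_def] at h'
  rw [show deriv (fun s => waveProfileDeriv k t √s / (2 * √s ^ 2)
    - waveProfile k t √s / (2 * √s ^ 3)) s = _ from h']
  have hs2 : s = √s ^ 2 := (Real.sq_sqrt hs.le).symm
  simp only [wave, waveSource, Pi.pow_apply]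
  generalize √s = r at *
  subst hs2
  field_simp
  ring

lemma laplacian_radial {F : ℝ → ℝ} (hF : ContDiff ℝ ∞ F) (a x : R3) :
    ∑ j, pd (pd (fun x : R3 => F (‖x - a‖ ^ 2)) j) j x
      = 4 * ‖x - a‖ ^ 2 * deriv (deriv F) (‖x - a‖ ^ 2) + 6 * deriv F (‖x - a‖ ^ 2) := by
  have hF' : ContDiff ℝ ∞ (deriv F) := (contDiff_infty_iff_deriv.1 hF).2
  have hd : Differentiable ℝ F := hF.differentiable (by simp)
  have hd' : Differentiable ℝ (deriv F) := hF'.differentiable (by simp)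
  have h1 : ∀ j, pd (fun x : R3 => F (‖x - a‖ ^ 2)) j
      = fun x => (2 * (x j - a j)) • deriv F (‖x - a‖ ^ 2) := fun j =>
    funext fun x => pd_radial hd a j x
  have h2 : ∀ j, HasFDerivAt (fun x : R3 => 2 * (x j - a j))
      ((2 : ℝ) • (EuclideanSpace.proj j : R3 →L[ℝ] ℝ)) x := fun j =>
    (((EuclideanSpace.proj j : R3 →L[ℝ] ℝ).hasFDerivAt (x := x)).sub_const (a j)).const_mul 2
  have h3 : ∀ j, pd (pd (fun x : R3 => F (‖x - a‖ ^ 2)) j) j x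
      = 2 * deriv F (‖x - a‖ ^ 2)
        + 4 * (x j - a j) ^ 2 * deriv (deriv F) (‖x - a‖ ^ 2) := fun j => by
    rw [h1, pd_smul (h2 j).differentiableAt
      (((contDiff_radial hF' a).differentiable (by simp)) x), pd_radial hd', pd, (h2 j).fderiv]
    simp
    ring
  have h4 : ‖x - a‖ ^ 2 = (x 0 - a 0) ^ 2 + (x 1 - a 1) ^ 2 + (x 2 - a 2) ^ 2 := by
    simp [EuclideanSpace.real_norm_sq_eq, Fin.sum_univ_three]
  simp only [h3, Fin.sum_univ_three]
  generalize deriv (deriv F) (‖x - a‖ ^ 2) = F₂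
  rw [h4]
  ring

lemma waveSource_eq_zero {k t r : ℝ} (ht : 0 < t) (h : r < t ∨ 2 * t < r) :
    waveSource k t r = 0 := by
  have h' : r / t < 1 ∨ 2 < r / t := by
    rwa [div_lt_one ht, lt_div_iff₀ ht]
  simp [waveSource, deriv_step_eq_zero h', deriv_deriv_step_eq_zero h']

lemma helmholtz_wave_radial {k t : ℝ} (ht : 0 < t) (r : ℝ) (hr : 0 ≤ r) :
    4 * r ^ 2 * deriv (deriv (wave k t)) (r ^ 2) + 6 * deriv (wave k t) (r ^ 2)
      + k ^ 2 * wave k t (r ^ 2) = waveSource k t r := by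
  rcases hr.eq_or_lt with rfl | hr
  · have h0 : wave k t =ᶠ[𝓝 0] fun _ => 0 := by
      filter_upwards [Iio_mem_nhds (pow_pos ht 2)] with s hs using wave_eq_zero ht hs
    simp [waveSource, h0.deriv_eq, h0.eq_of_nhds]
  · rw [helmholtz_wave (pow_pos hr 2), Real.sqrt_sq hr.le]

/-- The source lives on `t ≤ r ≤ 2t`: each derivative of the step costs `1/t`, and so does the
division by `r`. The term `1/t³` governs small scales and `1/t²` large ones. -/
lemma exists_waveSource_bound (k : ℝ) : ∃ C, 0 ≤ C ∧ ∀ t, 0 < t → ∀ r,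
    |waveSource k t r| ≤ C * (1 / t ^ 2 + 1 / t ^ 3) := by
  obtain ⟨B, hB0, hB⟩ := exists_bound_of_eq_zero contDiff_deriv_step.continuous
    fun _ => deriv_step_eq_zero
  obtain ⟨D, hD0, hD⟩ := exists_bound_of_eq_zero contDiff_deriv_deriv_step.continuous
    fun _ => deriv_deriv_step_eq_zero
  refine ⟨2 * |k| * B + D, by positivity, fun t ht r => ?_⟩
  by_cases hr : r < t
  · rw [waveSource_eq_zero ht (Or.inl hr), abs_zero]
    positivity
  have hr' : t ≤ r := not_lt.1 hr
  have hr0 : 0 < r := ht.trans_le hr'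
  have h1 : |(-2 * k * Real.sin (k * r) * (deriv step (r / t) / t)
      + Real.cos (k * r) * (deriv (deriv step) (r / t) / t ^ 2))|
      ≤ 2 * |k| * B / t + D / t ^ 2 := by
    refine (abs_add_le _ _).trans (add_le_add ?_ ?_)
    · rw [abs_mul, abs_mul, abs_mul, abs_div, abs_neg, abs_two, abs_of_pos ht, mul_div_assoc]
      have := Real.abs_sin_le_one (k * r)
      calc 2 * |k| * |Real.sin (k * r)| * (|deriv step (r / t)| / t)
          ≤ 2 * |k| * 1 * (B / t) := by gcongr; exact hB _
        _ = _ := by ring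
    · rw [abs_mul, abs_div, abs_of_pos (pow_pos ht 2)]
      have := Real.abs_cos_le_one (k * r)
      calc |Real.cos (k * r)| * (|deriv (deriv step) (r / t)| / t ^ 2)
          ≤ 1 * (D / t ^ 2) := by gcongr; exact hD _
        _ = _ := by ring
  rw [waveSource, abs_div, abs_of_pos hr0]
  calc _ ≤ (2 * |k| * B / t + D / t ^ 2) / t :=
        div_le_div₀ (by positivity) h1 ht hr'
    _ = 2 * |k| * B * (1 / t ^ 2) + D * (1 / t ^ 3) := by field_simp
    _ ≤ (2 * |k| * B + D) * (1 / t ^ 2) + (2 * |k| * B + D) * (1 / t ^ 3) := by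
        gcongr
        · linarith
        · have : 0 ≤ 2 * |k| * B := by positivity
          linarith
    _ = _ := by ring

lemma measurable_waveSource (k t : ℝ) : Measurable (waveSource k t) := by
  have h1 : Measurable fun r => deriv step (r / t) :=
    contDiff_deriv_step.continuous.measurable.comp (measurable_id.div_const t)
  have h2 : Measurable fun r => deriv (deriv step) (r / t) :=
    contDiff_deriv_deriv_step.continuous.measurable.comp (measurable_id.div_const t)
  unfold waveSource
  fun_prop

lemma integrable_waveSource_smul (k : ℝ) {t : ℝ} (ht : 0 < t) (a : R3) {h : R3 → ℂ}
    (hh : LocallyIntegrable h volume) : Integrable fun y => waveSource k t ‖y - a‖ • h y := by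
  obtain ⟨C, hC0, hC⟩ := exists_waveSource_bound k
  have hm : Measurable fun y : R3 => waveSource k t ‖y - a‖ :=
    (measurable_waveSource k t).comp (by fun_prop)
  have h1 : Integrable ((Metric.closedBall a (2 * t)).indicator h) := by
    rw [integrable_indicator_iff measurableSet_closedBall]
    exact hh.integrableOn_isCompact (isCompact_closedBall _ _)
  refine (h1.bdd_smul (φ := fun y : R3 => waveSource k t ‖y - a‖) _ hm.aestronglyMeasurable
    (Eventually.of_forall fun y => hC t ht _)).congr (Eventually.of_forall fun y => ?_)
  by_cases hy : y ∈ Metric.closedBall a (2 * t)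
  · simp [hy]
  · rw [mem_closedBall_iff_norm, not_le] at hy
    simp [waveSource_eq_zero ht (Or.inr hy)]

/-- Testing the Helmholtz equation with the difference of two truncated spherical waves. -/
lemma integral_waveSource_eq {k : ℝ} {h : R3 → ℂ} (hh : LocallyIntegrable h volume)
    (helm : ∀ ψ : R3 → ℝ, ContDiff ℝ ∞ ψ → HasCompactSupport ψ →
      ∫ x, (∑ j, pd (pd ψ j) j x + k ^ 2 * ψ x) • h x = 0) (a : R3) {t R : ℝ} (ht : 0 < t)
    (hR : 0 < R) :
    ∫ y, waveSource k t ‖y - a‖ • h y = ∫ y, waveSource k R ‖y - a‖ • h y := by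
  have hF : ContDiff ℝ ∞ fun s => wave k t s - wave k R s := (contDiff_wave ht).sub (contDiff_wave hR)
  have hdiff : ∀ {t : ℝ}, 0 < t → Differentiable ℝ (wave k t) := fun ht =>
    (contDiff_wave ht).differentiable (by simp)
  have hdiff' : ∀ {t : ℝ}, 0 < t → Differentiable ℝ (deriv (wave k t)) := fun ht =>
    (contDiff_infty_iff_deriv.1 (contDiff_wave ht)).2.differentiable (by simp)
  have hd : deriv (fun s => wave k t s - wave k R s)
      = fun s => deriv (wave k t) s - deriv (wave k R) s :=
    funext fun s => deriv_fun_sub (hdiff ht s) (hdiff hR s)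
  have hd2 : ∀ s, deriv (fun s => deriv (wave k t) s - deriv (wave k R) s) s
      = deriv (deriv (wave k t)) s - deriv (deriv (wave k R)) s := fun s =>
    deriv_fun_sub (hdiff' ht s) (hdiff' hR s)
  -- Far from `a` both truncations equal `1`, so the two waves cancel.
  have hs : HasCompactSupport fun x : R3 => wave k t (‖x - a‖ ^ 2) - wave k R (‖x - a‖ ^ 2) := by
    refine HasCompactSupport.intro (isCompact_closedBall a (2 * t + 2 * R)) fun x hx => ?_
    rw [mem_closedBall_iff_norm, not_le] at hx
    have h1 : 2 ≤ ‖x - a‖ / t := by rw [le_div_iff₀ ht]; linarith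
    have h2 : 2 ≤ ‖x - a‖ / R := by rw [le_div_iff₀ hR]; linarith
    simp [wave, waveProfile, Real.sqrt_sq (norm_nonneg (x - a)), step_eq_one h1, step_eq_one h2]
  have key := helm _ (contDiff_radial hF a) hs
  rw [← sub_eq_zero, ← integral_sub (integrable_waveSource_smul k ht a hh)
    (integrable_waveSource_smul k hR a hh), ← key]
  refine integral_congr_ae (Eventually.of_forall fun x => ?_)
  simp only
  rw [laplacian_radial hF, hd, hd2, ← sub_smul,
    ← helmholtz_wave_radial ht _ (norm_nonneg (x - a)),
    ← helmholtz_wave_radial hR _ (norm_nonneg (x - a))]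
  congr 1
  ring

/-- Up to the factor `-4π`, `cos(kr)/r` is a fundamental solution. In polar coordinates with `r =
ts`, the radial integral tends to that of `s b''(s) = (s b' - b)'`, which is `-1`; the factor `3
vol(B₁)` is the area of the unit sphere. -/
lemma tendsto_integral_waveSource (k : ℝ) (a : R3) :
    Tendsto (fun t => ∫ y : R3, waveSource k t ‖y - a‖) (𝓝[>] 0)
      (𝓝 (-(3 * volume.real (Metric.ball (0 : R3) 1)))) := by
  set m : ℝ → ℝ → ℝ := fun t s => s * (-2 * k * t * Real.sin (k * t * s) * deriv step s
    + Real.cos (k * t * s) * deriv (deriv step) s) with hm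
  have hmc : Continuous (Function.uncurry m) := by
    have h1 := contDiff_deriv_step.continuous
    have h2 := contDiff_deriv_deriv_step.continuous
    simp only [hm, Function.uncurry_def]
    fun_prop
  have hG : Continuous fun t => ∫ s in (0 : ℝ)..3, m t s :=
    intervalIntegral.continuous_parametric_intervalIntegral_of_continuous' hmc 0 3
  -- The endpoint `3` lies beyond the transition interval `[1, 2]`, so there `b = 1` and `b' = 0`.
  have hG0 : ∫ s in (0 : ℝ)..3, m 0 s = -1 := by
    have hder : ∀ s ∈ Set.uIcc (0 : ℝ) 3,
        HasDerivAt (fun s => s * deriv step s - step s) (m 0 s) s := fun s _ => by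
      refine (((hasDerivAt_id s).mul (hasDerivAt_deriv_step s)).sub
        (hasDerivAt_step s)).congr_deriv ?_
      simp [hm]
    rw [intervalIntegral.integral_eq_sub_of_hasDerivAt hder
      ((hmc.comp (Continuous.prodMk_right (0 : ℝ))).intervalIntegrable _ _),
      deriv_step_eq_zero (Or.inr (by norm_num)), step_eq_one (by norm_num),
      step_eq_zero (by norm_num)]
    norm_num
  have hev : ∀ t, 0 < t → ∫ y : R3, waveSource k t ‖y - a‖
      = 3 * volume.real (Metric.ball (0 : R3) 1) * ∫ s in (0 : ℝ)..3, m t s := fun t ht => by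
    rw [integral_sub_right_eq_self (fun y : R3 => waveSource k t ‖y‖) a,
      integral_fun_norm_addHaar volume (waveSource k t), finrank_euclideanSpace_fin]
    have hcv := integral_comp_mul_left_Ioi (fun r => r ^ (3 - 1) • waveSource k t r) 0 ht
    rw [mul_zero, smul_eq_mul, ← div_eq_inv_mul, eq_div_iff ht.ne'] at hcv
    rw [← hcv, ← integral_mul_const, intervalIntegral.integral_of_le (by norm_num)]
    have hsub := setIntegral_eq_of_subset_of_forall_sdiff_eq_zero (μ := volume) (f := m t)
      (s := Set.Ioc (0 : ℝ) 3) (t := Set.Ioi 0) measurableSet_Ioi Set.Ioc_subset_Ioi_self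
      fun s hs => by
        have h2 : 2 < s := by
          by_contra! hc
          exact hs.2 ⟨hs.1, by linarith⟩
        simp [hm, deriv_step_eq_zero (Or.inr h2), deriv_deriv_step_eq_zero (Or.inr h2)]
    rw [← hsub, nsmul_eq_mul, smul_eq_mul, mul_assoc]
    congr 2
    refine setIntegral_congr_fun measurableSet_Ioi fun s hs => ?_
    have hs0 : s ≠ 0 := (Set.mem_Ioi.1 hs).ne'
    simp only [waveSource, hm, smul_eq_mul, mul_div_cancel_left₀ s ht.ne', ← mul_assoc]
    field_simp
    ring
  have := ((hG.tendsto 0).mono_left (nhdsWithin_le_nhds (s := Set.Ioi 0))).const_mul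
    (3 * volume.real (Metric.ball (0 : R3) 1))
  rw [hG0, mul_neg_one] at this
  refine this.congr' ?_
  filter_upwards [self_mem_nhdsWithin] with t ht using (hev t ht).symm

/-! ### Vanishing of decaying Helmholtz solutions. -/

/-- The sources concentrate at a point as their scale tends to zero. -/
lemma ae_eq_zero_of_integral_waveSource {k : ℝ} {h : R3 → ℂ} (hh : LocallyIntegrable h volume)
    (h0 : ∀ (a : R3) (t : ℝ), 0 < t → ∫ y, waveSource k t ‖y - a‖ • h y = 0) :
    ∀ᵐ x ∂(volume : Measure R3), h x = 0 := by
  obtain ⟨C, hC0, hC⟩ := exists_waveSource_bound k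
  set V := volume.real (Metric.ball (0 : R3) 1) with hV
  have hV0 : 0 < V := 
    ENNReal.toReal_pos (Metric.measure_ball_pos _ _ one_pos).ne' measure_ball_lt_top.ne
  filter_upwards [(Besicovitch.vitaliFamily (volume : Measure R3)).ae_tendsto_average_norm_sub hh]
    with x hx
  have h2t : Tendsto (fun t : ℝ => 2 * t) (𝓝[>] 0) (𝓝[>] 0) := by
    refine tendsto_nhdsWithin_iff.2 ⟨?_, ?_⟩
    · have : Tendsto (fun t : ℝ => 2 * t) (𝓝 0) (𝓝 (2 * 0)) := tendsto_id.const_mul 2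
      rw [mul_zero] at this
      exact this.mono_left nhdsWithin_le_nhds
    · filter_upwards [self_mem_nhdsWithin] with t ht
      exact mul_pos two_pos (Set.mem_Ioi.1 ht)
  -- The normalised sources form an approximate identity: mass tending to `1`, support in the ball
  -- of radius `2t`, and for `t < 1` the bound `2C/(3Vt³) = (16C/3)/((2t)³V)`. They converge at
  -- Lebesgue points.
  have hlim := tendsto_integral_smul_of_tendsto_average_norm_sub
    (g := fun t y => -(3 * V)⁻¹ * waveSource k t ‖y - x‖) (16 * C / 3)
    ((hx.comp (Besicovitch.tendsto_filterAt volume x)).comp h2t)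
    (Eventually.of_forall fun t => hh.integrableOn_isCompact (isCompact_closedBall _ _))
    (by
      simp only [integral_const_mul]
      have := (tendsto_integral_waveSource k x).const_mul (-(3 * V)⁻¹)
      rwa [neg_mul_neg, inv_mul_cancel₀ (by positivity)] at this)
    (by
      filter_upwards [self_mem_nhdsWithin] with t ht y hy
      rw [mem_closedBall_iff_norm]
      by_contra! hc
      exact hy (by simp [waveSource_eq_zero ht (Or.inr hc)]))
    (by
      filter_upwards [self_mem_nhdsWithin, Ioo_mem_nhdsGT one_pos] with t ht ht1 y
      have ht0 : 0 < t := ht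
      rw [Measure.addHaar_real_closedBall _ _ (by positivity), finrank_euclideanSpace_fin, abs_mul,
        abs_neg, abs_of_pos (by positivity)]
      have h23 : 1 / t ^ 2 ≤ 1 / t ^ 3 :=
        one_div_le_one_div_of_le (by positivity) (pow_le_pow_of_le_one ht0.le ht1.2.le (by norm_num))
      calc (3 * V)⁻¹ * |waveSource k t ‖y - x‖| ≤ (3 * V)⁻¹ * (C * (1 / t ^ 3 + 1 / t ^ 3)) := by
            gcongr
            exact (hC t ht0 _).trans (by gcongr)
        _ = 16 * C / 3 / ((2 * t) ^ 3 * V) := by field_simp; ring)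
  have hz : ∀ᶠ t in 𝓝[>] (0 : ℝ), ∫ y, (-(3 * V)⁻¹ * waveSource k t ‖y - x‖) • h y = 0 := by
    filter_upwards [self_mem_nhdsWithin] with t ht
    simp only [mul_smul, integral_smul]
    rw [h0 x t ht, smul_zero]
  exact tendsto_nhds_unique hlim (tendsto_const_nhds.congr' (hz.mono fun _ h => h.symm))

/-- A locally integrable distributional solution of the Helmholtz equation on `ℝ³` which decays
faster than `1 / |x|` in mean vanishes. -/
lemma ae_eq_zero_of_helmholtz {k : ℝ} {h : R3 → ℂ} (hh : LocallyIntegrable h volume)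
    (helm : ∀ ψ : R3 → ℝ, ContDiff ℝ ∞ ψ → HasCompactSupport ψ →
      ∫ x, (∑ j, pd (pd ψ j) j x + k ^ 2 * ψ x) • h x = 0)
    (decay : ∀ η : ℝ, 0 < η → ∀ᶠ R in atTop, (∫ x in shell R, ‖h x‖) / R ^ 2 ≤ η) :
    ∀ᵐ x ∂(volume : Measure R3), h x = 0 := by
  refine ae_eq_zero_of_integral_waveSource (k := k) hh fun a t ht => ?_
  obtain ⟨C, hC0, hC⟩ := exists_waveSource_bound k
  rw [← norm_le_zero_iff]
  refine le_of_forall_pos_le_add fun ε hε => ?_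
  rw [zero_add]
  obtain ⟨R, hR, hR1, hRa⟩ := ((decay (ε / (2 * C + 1)) (by positivity)).and
    ((eventually_ge_atTop 1).and (eventually_ge_atTop (2 * ‖a‖)))).exists
  have hR0 : 0 < R := one_pos.trans_le hR1
  rw [integral_waveSource_eq hh helm a ht hR0]
  have hsm := (isCompact_shell R).measurableSet
  have hhi : IntegrableOn (fun x => ‖h x‖) (shell R) :=
    (hh.integrableOn_isCompact (isCompact_shell R)).norm
  have hle : ‖∫ y, waveSource k R ‖y - a‖ • h y‖
      ≤ ∫ y, 2 * C / R ^ 2 * (shell R).indicator (fun x => ‖h x‖) y := by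
    refine norm_integral_le_of_norm_le ((hhi.integrable_indicator hsm).const_mul _)
      (Eventually.of_forall fun y => ?_)
    by_cases hy : waveSource k R ‖y - a‖ = 0
    · rw [hy, zero_smul, norm_zero]
      exact mul_nonneg (by positivity) (Set.indicator_nonneg (fun _ _ => norm_nonneg _) _)
    · have h1 : R ≤ ‖y - a‖ := by
        by_contra! hc
        exact hy (waveSource_eq_zero hR0 (Or.inl hc))
      have h2 : ‖y - a‖ ≤ 2 * R := by
        by_contra! hc
        exact hy (waveSource_eq_zero hR0 (Or.inr hc))
      -- As `|a| ≤ R/2`, the source region `R ≤ |y - a| ≤ 2R` lies in `R/2 ≤ |y| ≤ 5R/2`.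
      have hys : y ∈ shell R := by
        have h3 := norm_sub_le y a
        have h4 := norm_le_norm_add_norm_sub' y a
        exact ⟨by linarith, by linarith⟩
      rw [Set.indicator_of_mem hys, norm_smul]
      refine mul_le_mul_of_nonneg_right ?_ (norm_nonneg _)
      have h23 : 1 / R ^ 3 ≤ 1 / R ^ 2 :=
        one_div_le_one_div_of_le (by positivity) (pow_le_pow_right₀ hR1 (by norm_num))
      calc ‖waveSource k R ‖y - a‖‖ ≤ C * (1 / R ^ 2 + 1 / R ^ 3) := hC R hR0 _
        _ ≤ C * (1 / R ^ 2 + 1 / R ^ 2) := by gcongr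
        _ = _ := by ring
  refine hle.trans ?_
  rw [integral_const_mul, integral_indicator hsm]
  calc 2 * C / R ^ 2 * ∫ x in shell R, ‖h x‖ = 2 * C * ((∫ x in shell R, ‖h x‖) / R ^ 2) := by ring
    _ ≤ 2 * C * (ε / (2 * C + 1)) := by gcongr
    _ ≤ ε := by
      rw [mul_div_assoc', div_le_iff₀ (by positivity)]
      nlinarith

/-! ### Linearity and conclusion. -/

lemma integrable_sum_mul_curl {u : R3 → C3} (hu : MemL2Loc u) {φ : R3 → C3}
    (hφ : ContDiff ℝ ∞ φ) (hφs : HasCompactSupport φ) :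
    Integrable fun x => ∑ i, u x i * curl φ x i := by
  have hd : Differentiable ℝ φ := hφ.differentiable (by simp)
  have hc : ∀ i, ContDiff ℝ ∞ fun y => φ y i := fun i =>
    ((EuclideanSpace.proj i : C3 →L[ℂ] ℂ).restrictScalars ℝ).contDiff.comp hφ
  have hcs : ∀ i, HasCompactSupport fun y => φ y i := fun i =>
    hφs.comp_left (g := fun v : C3 => v i) rfl
  have hp : ∀ j i, pderiv φ j i = pd (fun y => φ y i) j := fun j i =>
    funext fun x => pderiv_eq_pd (hd x) j i
  have hI : ∀ l j i, Integrable fun x => u x l * pderiv φ j i x := fun l j i => by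
    rw [hp]
    exact (hu.component l).integrable_mul_test (contDiff_pd (hc i) j).continuous
      (hasCompactSupport_pd (hcs i) j)
  refine ((((hI 0 1 2).sub (hI 0 2 1)).add ((hI 1 2 0).sub (hI 1 0 2))).add
    ((hI 2 0 1).sub (hI 2 1 0))).congr (Eventually.of_forall fun x => ?_)
  simp [curl, Fin.sum_univ_three, mul_sub]

lemma integrable_sum_mul_test {u : R3 → C3} (hu : MemL2Loc u) {φ : R3 → C3}
    (hφ : ContDiff ℝ ∞ φ) (hφs : HasCompactSupport φ) :
    Integrable fun x => ∑ i, u x i * φ x i :=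
  integrable_finsetSum _ fun i _ => (hu.component i).integrable_mul_test
    (((EuclideanSpace.proj i : C3 →L[ℂ] ℂ).continuous).comp hφ.continuous)
    (hφs.comp_left (g := fun v : C3 => v i) rfl)

lemma HasDistribCurl.sub {u u' w w' : R3 → C3} (h : HasDistribCurl u w) (h' : HasDistribCurl u' w')
    (hu : MemL2Loc u) (hu' : MemL2Loc u') (hw : MemL2Loc w) (hw' : MemL2Loc w') :
    HasDistribCurl (fun x => u x - u' x) fun x => w x - w' x := by
  intro φ hφ hφs
  simp only [PiLp.sub_apply, sub_mul, Finset.sum_sub_distrib]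
  rw [integral_sub (integrable_sum_mul_curl hu hφ hφs) (integrable_sum_mul_curl hu' hφ hφs),
    integral_sub (integrable_sum_mul_test hw hφ hφs) (integrable_sum_mul_test hw' hφ hφs),
    h φ hφ hφs, h' φ hφ hφs]

lemma HasDistribCurl.congr_ae {u w w' : R3 → C3} (h : HasDistribCurl u w)
    (hw : w =ᵐ[volume] w') : HasDistribCurl u w' := by
  intro φ hφ hφs
  refine (h φ hφ hφs).trans (integral_congr_ae ?_)
  filter_upwards [hw] with x hx
  rw [hx]

lemma applyTensor_sub (A : R3 → Matrix (Fin 3) (Fin 3) ℂ) (u v : R3 → C3) (x : R3) :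
    applyTensor A (fun x => u x - v x) x = applyTensor A u x - applyTensor A v x := by
  simp [applyTensor, Matrix.mulVec_sub]

lemma radialCross_sub (x : R3) (u v : C3) :
    radialCross x (u - v) = radialCross x u - radialCross x v := by
  simp [radialCross]

lemma waveNumber_pos {w ε₀ μ₀ : ℝ} (hw : 0 < w) (hε₀ : 0 < ε₀) (hμ₀ : 0 < μ₀) :
    0 < waveNumber w ε₀ μ₀ :=
  mul_pos hw (Real.sqrt_pos.2 (mul_pos hε₀ hμ₀))

lemma waveNumber_sq {w ε₀ μ₀ : ℝ} (hε₀ : 0 < ε₀) (hμ₀ : 0 < μ₀) :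
    waveNumber w ε₀ μ₀ ^ 2 = (w * ε₀) * (w * μ₀) := by
  rw [waveNumber, mul_pow, Real.sq_sqrt (mul_pos hε₀ hμ₀).le]
  ring

/-- Decay in quadratic mean over shells implies decay in mean. -/
lemma shell_mean_le_of_sq {u : R3 → C3} (hu : MemL2Loc u)
    (h : ∀ η : ℝ, 0 < η → ∀ᶠ R in atTop, R⁻¹ * (∫ x in shell R, ‖u x‖ ^ 2) ≤ η) (i : Fin 3)
    {ε : ℝ} (hε : 0 < ε) : ∀ᶠ R in atTop, (∫ x in shell R, ‖u x i‖) / R ^ 2 ≤ ε := by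
  set V := volume.real (Metric.ball (0 : R3) 1)
  have hV0 : 0 < V :=
    ENNReal.toReal_pos (Metric.measure_ball_pos _ _ one_pos).ne' measure_ball_lt_top.ne
  -- Young's inequality `|u| ≤ η/(2R) + R|u|²/(2η)` is integrated over a shell of volume at most
  -- `27R³V`; this `η` makes each term at most `εR²/2`.
  set η := ε / (27 * V) with hη
  have hη0 : 0 < η := by positivity
  filter_upwards [h (η * ε) (by positivity), eventually_gt_atTop 0] with R hR hR0
  have hsq := hu.integrableOn_norm_sq (isCompact_shell R)
  have hfin : volume (shell R) ≠ ⊤ := (isCompact_shell R).measure_lt_top.ne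
  have hvol : volume.real (shell R) ≤ 27 * R ^ 3 * V := by
    calc volume.real (shell R) ≤ volume.real (Metric.closedBall (0 : R3) (3 * R)) :=
          measureReal_mono (fun x hx => by simpa using hx.2) (measure_closedBall_lt_top.ne)
      _ = 27 * R ^ 3 * V := by
          rw [Measure.addHaar_real_closedBall _ _ (by positivity), finrank_euclideanSpace_fin]
          ring
  have hle : ∫ x in shell R, ‖u x i‖
      ≤ ∫ x in shell R, (η / (2 * R) + R / (2 * η) * ‖u x‖ ^ 2) := by
    refine integral_mono
      ((hu.component i).locallyIntegrable.integrableOn_isCompact (isCompact_shell R)).norm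
      ((integrableOn_const hfin).add (hsq.const_mul _)) fun x => ?_
    refine (PiLp.norm_apply_le (u x) i).trans ?_
    have h2 : 2 * R * η * ‖u x‖ ≤ η ^ 2 + R ^ 2 * ‖u x‖ ^ 2 := by
      nlinarith [sq_nonneg (η - R * ‖u x‖)]
    have h3 : η / (2 * R) + R / (2 * η) * ‖u x‖ ^ 2
        = (η ^ 2 + R ^ 2 * ‖u x‖ ^ 2) / (2 * R * η) := by field_simp
    rw [h3, le_div_iff₀ (by positivity)]
    linarith
  rw [integral_add (by exact integrableOn_const hfin) (hsq.const_mul _), integral_const_mul,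
    setIntegral_const, smul_eq_mul] at hle
  rw [div_le_iff₀ (by positivity)]
  have h4 : volume.real (shell R) * (η / (2 * R)) ≤ ε / 2 * R ^ 2 := by
    calc _ ≤ 27 * R ^ 3 * V * (η / (2 * R)) := by gcongr
      _ = ε / 2 * R ^ 2 := by
        rw [hη]
        field_simp
  have h5 : R / (2 * η) * (∫ x in shell R, ‖u x‖ ^ 2) ≤ ε / 2 * R ^ 2 := by
    calc R / (2 * η) * (∫ x in shell R, ‖u x‖ ^ 2)
        = R ^ 2 / (2 * η) * (R⁻¹ * ∫ x in shell R, ‖u x‖ ^ 2) := by field_simp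
      _ ≤ R ^ 2 / (2 * η) * (η * ε) := by gcongr
      _ = ε / 2 * R ^ 2 := by field_simp
  linarith

/-- Uniqueness for the homogeneous problem. -/
lemma ae_eq_zero_of_maxwell {α β k : ℝ} (hα : 0 < α) (hβ : 0 < β) (hk : 0 < k)
    (hkk : k ^ 2 = α * β) {Ω : Set R3} (hΩ : IsOpen Ω) (hΩb : Bornology.IsBounded Ω)
    {εeff : Matrix (Fin 3) (Fin 3) ℝ} (hε : εeff.PosDef) {μeff : Matrix (Fin 3) (Fin 3) ℂ}
    (hμ : μeff.IsSymm) (hμ' : (μeff.map Complex.im).PosDef)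
    {E H : R3 → C3} (hE : MemL2Loc E) (hH : MemL2Loc H)
    (curl_E : HasDistribCurl E fun x =>
      (Complex.I * β) • applyTensor (tensorField Ω μeff) H x)
    (curl_H : HasDistribCurl H fun x =>
      (-Complex.I * α) • applyTensor (tensorField Ω (εeff.map Complex.ofReal)) E x)
    (hS : (fun x => (α : ℂ) • radialCross x (E x) - (k : ℂ) • H x)
      =o[aeInfinity] fun x => ‖x‖⁻¹) :
    E =ᵐ[volume] 0 ∧ H =ᵐ[volume] 0 := by
  have hΩm := hΩ.measurableSet
  have hεs : εeff.IsSymm := by simpa using hε.isHermitian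
  have hβI : Complex.I * (β : ℂ) ≠ 0 := by simp [hβ.ne']
  have hαI : -Complex.I * (α : ℂ) ≠ 0 := by simp [hα.ne']
  set V := volume.real (Metric.ball (0 : R3) 1)
  have hV0 : 0 < V :=
    ENNReal.toReal_pos (Metric.measure_ball_pos _ _ one_pos).ne' measure_ball_lt_top.ne
  have hest : ∀ δ : ℝ, 0 < δ → ∀ᶠ R in atTop,
      β * cutoff 0 * (∫ x in Ω, absorption μeff (H x))
        + k / (2 * α) * (R⁻¹ * ∫ x in shell R, ‖H x‖ ^ 2) ≤ δ := fun δ hδ => by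
    have h := energy_estimate hα hk hΩm hΩb hεs hE hH curl_E curl_H hS
      -- This choice makes the right-hand side of the energy estimate equal to `δ`.
      (η := √(δ * (2 * α * k) / (384 * V))) (Real.sqrt_pos.2 (by positivity))
    refine h.mono fun R hR => hR.trans_eq ?_
    rw [Real.sq_sqrt (by positivity)]
    change 1 / (2 * α * k) * (384 * V * (δ * (2 * α * k) / (384 * V))) = δ
    field_simp
  have habs : 0 ≤ ∫ x in Ω, absorption μeff (H x) := by
    refine integral_nonneg fun x => ?_
    by_cases hx : H x = 0
    · simp [hx, absorption]
    · exact (absorption_pos hμ hμ' hx).le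
  have hc := mul_pos hβ cutoff_zero_pos
  have hHΩ : ∀ᵐ x ∂(volume : Measure R3), x ∈ Ω → H x = 0 := by
    refine ae_eq_zero_of_energy hc hΩm hΩb hμ hμ' hH fun η hη => ?_
    obtain ⟨R, hR, hR0⟩ := ((hest η hη).and (eventually_gt_atTop 0)).exists
    have : 0 ≤ k / (2 * α) * (R⁻¹ * ∫ x in shell R, ‖H x‖ ^ 2) :=
      mul_nonneg (by positivity) (mul_nonneg (by positivity)
        (integral_nonneg fun x => sq_nonneg _))
    linarith
  have hdecay : ∀ η : ℝ, 0 < η → ∀ᶠ R in atTop, R⁻¹ * (∫ x in shell R, ‖H x‖ ^ 2) ≤ η :=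
    fun η hη => by
      filter_upwards [hest (k / (2 * α) * η) (by positivity)] with R hR
      have h1 := mul_nonneg hc.le habs
      exact le_of_mul_le_mul_left (by linarith) (show 0 < k / (2 * α) by positivity)
  have hzL := (memL2Loc_applyTensor hΩm (εeff.map Complex.ofReal) hE).const_smul (-Complex.I * α)
  -- `H` vanishes on the open set `Ω`, hence so does `curl H`, and `ε` is invertible.
  have hEΩ : ∀ᵐ x ∂(volume : Measure R3), x ∈ Ω → E x = 0 := by
    have hunit : IsUnit (εeff.map Complex.ofReal) := hε.isUnit.map Complex.ofRealHom.mapMatrix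
    filter_upwards [curl_H.ae_eq_zero hzL hΩ hHΩ] with x hx hxΩ
    have h1 := (smul_eq_zero.1 (hx hxΩ)).resolve_left hαI
    simp only [applyTensor, tensorField, hxΩ, if_true, WithLp.toLp_eq_zero] at h1
    have h2 := Matrix.mulVec_injective_of_isUnit hunit (h1.trans (Matrix.mulVec_zero _).symm)
    ext i
    exact congrFun h2 i
  -- Where a field vanishes its tensor is irrelevant, so both equations become those of vacuum on
  -- the whole space.
  have free : ∀ {A : Matrix (Fin 3) (Fin 3) ℂ} {u : R3 → C3} (c : ℂ),
      (∀ᵐ x ∂(volume : Measure R3), x ∈ Ω → u x = 0) →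
      (fun x => c • applyTensor (tensorField Ω A) u x) =ᵐ[volume] fun x => c • u x := by
    intro A u c hu
    filter_upwards [hu] with x hx
    by_cases hxΩ : x ∈ Ω
    · simp [applyTensor, hx hxΩ]
    · simp [applyTensor, tensorField, hxΩ]
  have cE := curl_E.congr_ae (free _ hHΩ)
  have cH := curl_H.congr_ae (free _ hEΩ)
  have hHi : ∀ i, ∀ᵐ x ∂(volume : Measure R3), H x i = 0 := fun i => by
    refine ae_eq_zero_of_helmholtz (k := k) (hH.component i).locallyIntegrable
      (fun ψ hψ hψs => ?_) fun η hη => shell_mean_le_of_sq hH hdecay i hη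
    have h := helmholtz_of_maxwell hβI hH cE cH (Complex.ofRealCLM.contDiff.comp hψ)
      (hψs.comp_left Complex.ofReal_zero) i
    rw [← h]
    refine integral_congr_ae (Eventually.of_forall fun x => ?_)
    have hd : ∀ j, pd (Complex.ofRealCLM ∘ ψ) j = fun x => ((pd ψ j x : ℝ) : ℂ) := fun j =>
      funext fun x => pd_ofReal ((hψ.differentiable (by simp)) x)
    have hdd : ∀ j, pd (pd (Complex.ofRealCLM ∘ ψ) j) j x = ((pd (pd ψ j) j x : ℝ) : ℂ) :=
      fun j => by
        rw [hd]
        exact pd_ofReal (((contDiff_pd hψ j).differentiable (by simp)) x)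
    have hab : -Complex.I * (α : ℂ) * (Complex.I * β) = ((k ^ 2 : ℝ) : ℂ) := by
      rw [hkk]
      push_cast
      linear_combination (-(α : ℂ) * β) * Complex.I_sq
    simp only [hdd, hab, Function.comp, Complex.ofRealCLM_apply, Complex.real_smul]
    push_cast
    ring
  have hH0 : ∀ᵐ x ∂(volume : Measure R3), H x = 0 := by
    filter_upwards [ae_all_iff.2 hHi] with x hx
    ext i
    exact hx i
  refine ⟨?_, hH0⟩
  filter_upwards [cH.ae_eq_zero (hE.const_smul _) isOpen_univ (hH0.mono fun x hx _ => hx)]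
    with x hx
  exact (smul_eq_zero.1 (hx (Set.mem_univ x))).resolve_left hαI

end MaxwellDiffraction

end

open MaxwellDiffraction in
theorem lemma2p1 (ω ε₀ μ₀ : ℝ) (hω : 0 < ω) (hε₀ : 0 < ε₀) (hμ₀ : 0 < μ₀)
    (Ω : Set MaxwellDiffraction.R3) (hΩ_open : IsOpen Ω) (hΩ_bdd : Bornology.IsBounded Ω)
    (εeff : Matrix (Fin 3) (Fin 3) ℝ) (hε : εeff.PosDef)
    (μeff : Matrix (Fin 3) (Fin 3) ℂ) (hμ_symm : μeff.IsSymm)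
    (hμ_im : (μeff.map Complex.im).PosDef)
    (Einc Hinc E₁ H₁ E₂ H₂ : MaxwellDiffraction.R3 → MaxwellDiffraction.C3)
    (h₁ : MaxwellDiffraction.IsSolution ω ε₀ μ₀ Ω εeff μeff Einc Hinc E₁ H₁)
    (h₂ : MaxwellDiffraction.IsSolution ω ε₀ μ₀ Ω εeff μeff Einc Hinc E₂ H₂) :
    E₁ =ᵐ[volume] E₂ ∧ H₁ =ᵐ[volume] H₂ := by
  have hΩm := hΩ_open.measurableSet
  have hE : MemL2Loc fun x => E₁ x - E₂ x := fun K hK =>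
    (h₁.E_memL2Loc K hK).sub (h₂.E_memL2Loc K hK)
  have hH : MemL2Loc fun x => H₁ x - H₂ x := fun K hK =>
    (h₁.H_memL2Loc K hK).sub (h₂.H_memL2Loc K hK)
  have cE := h₁.curl_E.sub h₂.curl_E h₁.E_memL2Loc h₂.E_memL2Loc
    ((memL2Loc_applyTensor hΩm _ h₁.H_memL2Loc).const_smul _)
    ((memL2Loc_applyTensor hΩm _ h₂.H_memL2Loc).const_smul _)
  have cH := h₁.curl_H.sub h₂.curl_H h₁.H_memL2Loc h₂.H_memL2Loc
    ((memL2Loc_applyTensor hΩm _ h₁.E_memL2Loc).const_smul _)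
    ((memL2Loc_applyTensor hΩm _ h₂.E_memL2Loc).const_smul _)
  simp only [← smul_sub, ← applyTensor_sub, mul_assoc, ← Complex.ofReal_mul] at cE cH
  have hS : (fun x => ((ω * ε₀ : ℝ) : ℂ) • radialCross x (E₁ x - E₂ x)
      - (waveNumber ω ε₀ μ₀ : ℂ) • (H₁ x - H₂ x)) =o[aeInfinity] fun x => ‖x‖⁻¹ := by
    -- The incident fields cancel in the difference of the two radiation conditions.
    refine (h₁.radiation.isLittleO.sub h₂.radiation.isLittleO).congr_left fun x => ?_
    simp only [radialCross_sub, smul_sub]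
    abel
  obtain ⟨h1, h2⟩ := ae_eq_zero_of_maxwell (mul_pos hω hε₀) (mul_pos hω hμ₀)
    (waveNumber_pos hω hε₀ hμ₀) (waveNumber_sq hε₀ hμ₀) hΩ_open hΩ_bdd hε hμ_symm hμ_im hE hH
    cE cH hS
  exact ⟨h1.mono fun x hx => sub_eq_zero.1 hx, h2.mono fun x hx => sub_eq_zero.1 hx⟩
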